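/- **Theorem (approximate counting with square-root error).** There is a universal constant $C>0$ such that for every integer $N\ge 1$ and all real $\varepsilon>0$ and $0<\zeta<1$ there is a quantum query algorithm (depending only on $N,\varepsilon,\zeta$) with the following properties. For every Boolean function $f\colon\{0,\dots,N-1\}\to\{0,1\}$ marking $K=|f^{-1}(1)|>0$ items, when the algorithm is given access to any membership oracle for $f$, it outputs an estimate $\hat K\in\mathbb{R}$ with $$|\hat K-K|<\varepsilon\sqrt K\quad\text{with probability at least }1-\zeta.$$ In every run it makes fewer than $C\,\varepsilon^{-1}\sqrt N\,\log\frac1\zeta$ oracle queries, and it uses at most $C\log(N+1)$ qubits, i.e. $O(\varepsilon^{-1}\sqrt N\log\frac1\zeta)$ queries and $O(\log N)$ qubits. Here a membership oracle for $f$ is a unitary $U_f$ on $\lceil\log_2 N\rceil$ qubits with $U_f|x\rangle=(-1)^{f(x)}|x\rangle$ for all $x\in\{0,\dots,N-1\}$, and a query is one application of $U_f$ to the data register, controlled by a further qubit. A quantum query algorithm starts with all its qubits (control, data register and workspace) in state $|0\rangle$ and performs finitely many steps, each of which is a unitary not depending on $f$, a query, or a measurement of all qubits in the computational basis; the later steps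 and the output may depend on the measurement outcomes. Classical memory and processing are not counted. -/

import Mathlib

namespace QuantumQuery

noncomputable section

/-- Labels of the computational basis of `1 + m + w` qubits: one control qubit, an `m`-qubit
data register and a `w`-qubit workspace, where a basis state of `r` qubits is labelled by the
number in `{0, …, 2 ^ r - 1}` that it encodes in binary. -/
abbrev Basis (m w : ℕ) : Type := Fin 2 × Fin (2 ^ m) × Fin (2 ^ w)

/-- State vectors (amplitudes in the computational basis). -/
abbrev State (m w : ℕ) : Type := Basis m w → ℂ

/-- The computational basis state with label `s`. -/
def ket {ι : Type} [DecidableEq ι] (s : ι) : ι → ℂ := Pi.single s 1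

/-- The number of qubits of the data register that holds an item of `{0, …, N - 1}`. -/
def dataQubits (N : ℕ) : ℕ := Nat.clog 2 N

/-- The item `x` of `{0, …, N - 1}` as a basis label of the data register. -/
def item {N : ℕ} (x : Fin N) : Fin (2 ^ dataQubits N) :=
  Fin.castLE (Nat.le_pow_clog one_lt_two N) x

/-- `U` is a membership oracle for `f`: a unitary operator on the data register with
`U |x⟩ = (-1) ^ f(x) |x⟩` for every item `x`. Nothing is assumed about its action on the
orthogonal complement of the items. -/
def IsMembershipOracle {N : ℕ} (f : Fin N → Bool)
    (U : Matrix (Fin (2 ^ dataQubits N)) (Fin (2 ^ dataQubits N)) ℂ) : Prop :=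
  U ∈ Matrix.unitaryGroup (Fin (2 ^ dataQubits N)) ℂ ∧
    ∀ x : Fin N, U.mulVec (ket (item x)) = ((-1 : ℂ) ^ (f x).toNat) • ket (item x)

/-- One oracle query: `U` acts on the data register, controlled by the control qubit. -/
def applyQuery {m w : ℕ} (U : Matrix (Fin (2 ^ m)) (Fin (2 ^ m)) ℂ) (ψ : State m w) :
    State m w :=
  fun s => if s.1 = 1 then ∑ y, U s.2.1 y * ψ (1, y, s.2.2) else ψ s

/-- Quantum query algorithms on `1 + m + w` qubits whose result is a real number. An algorithm
is a finite sequence of steps: stop with an output, apply a unitary (that does not depend on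
the oracle), make an oracle query, or measure all qubits in the computational basis and continue
in a way that may depend on the outcome. -/
inductive Algorithm (m w : ℕ) : Type
  | output (k : ℝ) : Algorithm m w
  | gate (V : Matrix.unitaryGroup (Basis m w) ℂ) (next : Algorithm m w) : Algorithm m w
  | query (next : Algorithm m w) : Algorithm m w
  | measure (next : Basis m w → Algorithm m w) : Algorithm m w

namespace Algorithm

variable {m w : ℕ}

/-- The number of qubits that an algorithm works on. -/
def qubits (_A : Algorithm m w) : ℕ := 1 + m + w

/-- The number of oracle queries in the worst case over all measurement outcomes. -/
def queries : Algorithm m w → ℕ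
  | output _ => 0
  | gate _ next => next.queries
  | query next => next.queries + 1
  | measure next => Finset.univ.sup fun s => (next s).queries

open Classical in
/-- The probability that the output lies in `S` if the algorithm is run with oracle `U` from
the unit vector `ψ`. A measurement has outcome `s` with probability `‖ψ s‖ ^ 2` and leaves
the qubits in the basis state with label `s`. -/
def probFrom (U : Matrix (Fin (2 ^ m)) (Fin (2 ^ m)) ℂ) (S : Set ℝ) :
    Algorithm m w → State m w → ℝ
  | output k, _ => if k ∈ S then 1 else 0
  | gate V next, ψ => probFrom U S next ((V : Matrix (Basis m w) (Basis m w) ℂ).mulVec ψ)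
  | query next, ψ => probFrom U S next (applyQuery U ψ)
  | measure next, ψ => ∑ s, ‖ψ s‖ ^ 2 * probFrom U S (next s) (ket s)

/-- The probability that the output lies in `S` if all qubits start in the state `|0⟩`. -/
def prob (A : Algorithm m w) (U : Matrix (Fin (2 ^ m)) (Fin (2 ^ m)) ℂ) (S : Set ℝ) : ℝ :=
  probFrom U S A (ket (0, 0, 0))

end Algorithm

end

end QuantumQuery

/-! Let `sin θ = √(K/N)`. One query followed by the reflection about the uniform superposition of
the items is a rotation by `2θ` in the plane of marked and unmarked items, so after `k` iterations
the amplitudes are governed by `sin ((2k+1)θ)` and `cos ((2k+1)θ)`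
(`diffusion_mulVec_oracle_mulVec`). The span of the items is preserved, so the action of the oracle
elsewhere is irrelevant.

The quantity estimated is `√K = √N |sin θ|`. Phase estimation runs `j` iterations in superposition
over `j < D`, weighted by a sine window, and applies the Fourier transform. By Parseval the mean
square error equals a Dirichlet energy of the window, so it is `O(N / D ^ 2)`
(`exists_sqrt_estimator`). Both eigenvalues `exp (±2iθ)` give the same `|sin θ|`, so it does not
matter which one is seen. An additive error `ε/3` for `√K` gives an error below `ε√K` for `K`
(`abs_countOfSqrt_sub_lt`), and it costs `O(√N/ε)` queries.

For `ζ` bounded away from `1`, `O(log (1/ζ))` repetitions and a majority vote reach failure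
probability `ζ` (`le_exp_repeatRun_majorityPoint`). For `ζ` near `1` the budget `log (1/ζ) ≈ 1 - ζ`
is less than one full run: an estimate coarser by a factor `M ≈ 1/(8(1-ζ))` is then refined by a
uniformly random guess among `6M+1` values (`exists_guess`).

For the qubit bound, `ε` is never taken below `1/(2√N)`: at that precision rounding already yields
`K` exactly. Hence `D = O(N)`. -/

namespace QuantumQuery

noncomputable section

/-! ### Norms of states -/

/-- The squared Euclidean norm of a vector of amplitudes. -/
def normSq {ι : Type} [Fintype ι] (ψ : ι → ℂ) : ℝ := ∑ s, ‖ψ s‖ ^ 2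

theorem normSq_eq_dotProduct {ι : Type} [Fintype ι] (ψ : ι → ℂ) :
    (normSq ψ : ℂ) = star ψ ⬝ᵥ ψ := by
  simp [normSq, dotProduct, Complex.conj_mul']

theorem normSq_mulVec {ι : Type} [Fintype ι] [DecidableEq ι] {V : Matrix ι ι ℂ}
    (hV : V ∈ Matrix.unitaryGroup ι ℂ) (ψ : ι → ℂ) : normSq (V.mulVec ψ) = normSq ψ := by
  have h : (normSq (V.mulVec ψ) : ℂ) = normSq ψ := by
    rw [normSq_eq_dotProduct, normSq_eq_dotProduct, Matrix.star_mulVec, ← Matrix.dotProduct_mulVec,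
      Matrix.mulVec_mulVec, ← Matrix.star_eq_conjTranspose, Matrix.mem_unitaryGroup_iff'.1 hV,
      Matrix.one_mulVec]
  exact_mod_cast h

theorem normSq_ket {ι : Type} [Fintype ι] [DecidableEq ι] (s : ι) : normSq (ket s) = 1 := by
  rw [normSq, Finset.sum_eq_single s]
  · simp [ket]
  · intro t _ ht
    simp [ket, ht]
  · simp

/-! ### Unitary gates -/

/-- Every unit vector is the image of a given basis state under some unitary. -/
theorem exists_unitary_mulVec_ket {ι : Type} [Fintype ι] [DecidableEq ι] (i : ι) (v : ι → ℂ)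
    (hv : normSq v = 1) : ∃ V : Matrix.unitaryGroup ι ℂ, V.1.mulVec (ket i) = v := by
  classical
  have hnorm : ‖(WithLp.toLp 2 v : EuclideanSpace ℂ ι)‖ = 1 := by
    rw [EuclideanSpace.norm_eq]
    change √(normSq v) = 1
    rw [hv, Real.sqrt_one]
  have ho : Orthonormal ℂ (({i} : Set ι).domRestrict
      (fun _ : ι => (WithLp.toLp 2 v : EuclideanSpace ℂ ι))) := by
    constructor
    · intro x
      exact hnorm
    · intro x y hxy
      exact absurd (Subsingleton.elim x y) hxy
  obtain ⟨b, hb⟩ := ho.exists_orthonormalBasis_extension_of_card_eq (by simp)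
  refine ⟨⟨(EuclideanSpace.basisFun ι ℂ).toBasis.toMatrix b,
    OrthonormalBasis.toMatrix_orthonormalBasis_mem_unitary _ _⟩, ?_⟩
  ext s
  have := hb i rfl
  simp [ket, Module.Basis.toMatrix_apply, this]

/-- The gate that permutes the basis states. -/
def permGate {ι : Type} [Fintype ι] [DecidableEq ι] (σ : Equiv.Perm ι) :
    Matrix.unitaryGroup ι ℂ :=
  ⟨Matrix.of fun s t => if σ s = t then 1 else 0, by
    rw [Matrix.mem_unitaryGroup_iff]
    ext s t
    simp [Matrix.mul_apply, Matrix.one_apply, Matrix.star_apply, apply_ite star]⟩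

theorem permGate_mulVec {ι : Type} [Fintype ι] [DecidableEq ι] (σ : Equiv.Perm ι) (ψ : ι → ℂ)
    (s : ι) : (permGate σ).1.mulVec ψ s = ψ (σ s) := by
  simp [permGate, Matrix.mulVec, dotProduct]

variable {m w : ℕ}

/-- The operator `A` on the data register, controlled by the control qubit. -/
def ctrl (w : ℕ) (A : Matrix (Fin (2 ^ m)) (Fin (2 ^ m)) ℂ) :
    Matrix (Basis m w) (Basis m w) ℂ :=
  Matrix.of fun s t => if s.1 = 1 then (if t.1 = 1 ∧ s.2.2 = t.2.2 then A s.2.1 t.2.1 else 0)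
    else if s = t then 1 else 0

theorem ctrl_mulVec (A : Matrix (Fin (2 ^ m)) (Fin (2 ^ m)) ℂ) (ψ : State m w) :
    (ctrl w A).mulVec ψ = applyQuery A ψ := by
  ext ⟨c, x, j⟩
  by_cases hc : c = 1
  · simp [ctrl, applyQuery, Matrix.mulVec, dotProduct, hc, Fintype.sum_prod_type, ite_and]
  · simp [ctrl, applyQuery, Matrix.mulVec, dotProduct, hc]

theorem normSq_applyQuery {A : Matrix (Fin (2 ^ m)) (Fin (2 ^ m)) ℂ}
    (hA : A ∈ Matrix.unitaryGroup (Fin (2 ^ m)) ℂ) (ψ : State m w) :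
    normSq (applyQuery A ψ) = normSq ψ := by
  have h : ∀ j, ∑ x, ‖applyQuery A ψ (1, x, j)‖ ^ 2 = ∑ x, ‖ψ (1, x, j)‖ ^ 2 := fun j => by
    simpa [applyQuery, normSq, Matrix.mulVec, dotProduct] using
      normSq_mulVec hA fun x => ψ (1, x, j)
  have h0 : ∀ x j, applyQuery A ψ (0, x, j) = ψ (0, x, j) := fun x j => by simp [applyQuery]
  simp only [normSq, Fintype.sum_prod_type, Fin.sum_univ_two, h0]
  congr 1
  rw [Finset.sum_comm, Finset.sum_congr rfl fun j _ => h j, Finset.sum_comm]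

theorem ctrl_mem_unitaryGroup {A : Matrix (Fin (2 ^ m)) (Fin (2 ^ m)) ℂ}
    (hA : A ∈ Matrix.unitaryGroup (Fin (2 ^ m)) ℂ) :
    ctrl w A ∈ Matrix.unitaryGroup (Basis m w) ℂ := by
  have hs : star (ctrl w A) = ctrl w (star A) := by
    ext ⟨c, x, j⟩ ⟨d, y, k⟩
    fin_cases c <;> fin_cases d <;> simp [ctrl, Matrix.star_apply, apply_ite star, eq_comm]
  rw [Matrix.mem_unitaryGroup_iff]
  refine Matrix.mulVec_injective (funext fun ψ => ?_)
  rw [← Matrix.mulVec_mulVec, hs, ctrl_mulVec, ctrl_mulVec, Matrix.one_mulVec]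
  ext ⟨c, x, j⟩
  by_cases hc : c = 1
  · have := congrFun (Matrix.mulVec_mulVec (fun x => ψ (1, x, j)) A (star A)) x
    rw [Matrix.mem_unitaryGroup_iff.1 hA, Matrix.one_mulVec] at this
    simpa [applyQuery, hc, Matrix.mulVec, dotProduct] using this
  · simp [applyQuery, hc]

/-- The operator `F` on the workspace. -/
def onWork (m : ℕ) (F : Matrix.unitaryGroup (Fin (2 ^ w)) ℂ) :
    Matrix.unitaryGroup (Basis m w) ℂ :=
  ⟨Matrix.kronecker 1 (Matrix.kronecker 1 F.1),
    Matrix.kronecker_mem_unitary (one_mem _) (Matrix.kronecker_mem_unitary (one_mem _) F.2)⟩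

theorem onWork_mulVec (F : Matrix.unitaryGroup (Fin (2 ^ w)) ℂ) (ψ : State m w)
    (c : Fin 2) (x : Fin (2 ^ m)) (t : Fin (2 ^ w)) :
    (onWork m F).1.mulVec ψ (c, x, t) = ∑ j, F.1 t j * ψ (c, x, j) := by
  simp [onWork, Matrix.mulVec, dotProduct, Fintype.sum_prod_type, Matrix.one_apply]

/-! ### Expected values of functions of the output -/

namespace Algorithm

/-- The expected value of `F` at the output if the algorithm is run with oracle `U` from `ψ`. -/
def expFrom (U : Matrix (Fin (2 ^ m)) (Fin (2 ^ m)) ℂ) (F : ℝ → ℝ) :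
    Algorithm m w → State m w → ℝ
  | output k, _ => F k
  | gate V next, ψ => expFrom U F next ((V : Matrix (Basis m w) (Basis m w) ℂ).mulVec ψ)
  | query next, ψ => expFrom U F next (applyQuery U ψ)
  | measure next, ψ => ∑ s, ‖ψ s‖ ^ 2 * expFrom U F (next s) (ket s)

/-- The expected value of `F` at the output if all qubits start in the state `|0⟩`. -/
def exp (U : Matrix (Fin (2 ^ m)) (Fin (2 ^ m)) ℂ) (F : ℝ → ℝ) (A : Algorithm m w) : ℝ :=
  expFrom U F A (ket (0, 0, 0))

variable {U : Matrix (Fin (2 ^ m)) (Fin (2 ^ m)) ℂ}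

/-- Expectations of arbitrary functions, unlike probabilities, compose under sequencing: the
expected value of the continuation is again a function of the first output (see `exp_bind`). All
later estimates are therefore made for `exp`. -/
theorem prob_eq_exp (A : Algorithm m w) (S : Set ℝ) :
    A.prob U S = exp U (S.indicator fun _ => 1) A := by
  classical
  have h : ∀ (A : Algorithm m w) ψ, probFrom U S A ψ = expFrom U (S.indicator fun _ => 1) A ψ := by
    intro A
    induction A with
    | output k => intro ψ; simp [probFrom, expFrom, Set.indicator_apply]
    | gate V next ih => intro ψ; exact ih _
    | query next ih => intro ψ; exact ih _
    | measure next ih => intro ψ; simp only [probFrom, expFrom, ih]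
  exact h A _

theorem expFrom_mono {F G : ℝ → ℝ} (h : ∀ x, F x ≤ G x) (A : Algorithm m w) (ψ : State m w) :
    expFrom U F A ψ ≤ expFrom U G A ψ := by
  induction A generalizing ψ with
  | output k => exact h k
  | gate V next ih => exact ih _
  | query next ih => exact ih _
  | measure next ih =>
    exact Finset.sum_le_sum fun s _ => mul_le_mul_of_nonneg_left (ih s _) (sq_nonneg _)

theorem exp_mono {F G : ℝ → ℝ} (h : ∀ x, F x ≤ G x) (A : Algorithm m w) :
    exp U F A ≤ exp U G A := expFrom_mono h A _

/-- The constant `a` gets the total probability as its weight. This is `1` because gates and queries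
preserve the norm, which is where unitarity of the oracle enters. -/
theorem expFrom_affine (hU : U ∈ Matrix.unitaryGroup (Fin (2 ^ m)) ℂ) (a b : ℝ) (F : ℝ → ℝ)
    (A : Algorithm m w) (ψ : State m w) (hψ : normSq ψ = 1) :
    expFrom U (fun x => a + b * F x) A ψ = a + b * expFrom U F A ψ := by
  induction A generalizing ψ with
  | output k => rfl
  | gate V next ih => exact ih _ (by rwa [normSq_mulVec V.2])
  | query next ih => exact ih _ (by rwa [normSq_applyQuery hU])
  | measure next ih =>
    simp only [expFrom, ih _ _ (normSq_ket _), mul_add, Finset.sum_add_distrib, Finset.mul_sum,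
      ← Finset.sum_mul]
    rw [normSq] at hψ
    rw [hψ, one_mul]
    congr 1
    exact Finset.sum_congr rfl fun s _ => by ring

theorem exp_affine (hU : U ∈ Matrix.unitaryGroup (Fin (2 ^ m)) ℂ) (a b : ℝ) (F : ℝ → ℝ)
    (A : Algorithm m w) : exp U (fun x => a + b * F x) A = a + b * exp U F A :=
  expFrom_affine hU a b F A _ (normSq_ket _)

/-- Apply a function to the output. -/
def map (g : ℝ → ℝ) : Algorithm m w → Algorithm m w
  | output k => output (g k)
  | gate V next => gate V (map g next)
  | query next => query (map g next)
  | measure next => measure fun s => map g (next s)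

theorem queries_map (g : ℝ → ℝ) (A : Algorithm m w) : (map g A).queries = A.queries := by
  induction A with
  | output k => rfl
  | gate V next ih => exact ih
  | query next ih => exact congrArg (· + 1) ih
  | measure next ih => simp only [map, queries, ih]

theorem exp_map (g F : ℝ → ℝ) (A : Algorithm m w) :
    exp U F (map g A) = exp U (fun x => F (g x)) A := by
  have h : ∀ (A : Algorithm m w) ψ, expFrom U F (map g A) ψ = expFrom U (fun x => F (g x)) A ψ := by
    intro A
    induction A with
    | output k => intro ψ; rfl
    | gate V next ih => intro ψ; exact ih _
    | query next ih => intro ψ; exact ih _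
    | measure next ih => intro ψ; simp only [map, expFrom, ih]
  exact h A _

/-- Run an algorithm, reset all qubits to `|0⟩`, and continue with an algorithm that depends on
the first output. -/
def bind (k : ℝ → Algorithm m w) : Algorithm m w → Algorithm m w
  | output x => measure fun s => gate (permGate (Equiv.swap s (0, 0, 0))) (k x)
  | gate V next => gate V (bind k next)
  | query next => query (bind k next)
  | measure next => measure fun s => bind k (next s)

theorem queries_bind_le {k : ℝ → Algorithm m w} {q : ℕ} (hk : ∀ x, (k x).queries ≤ q)
    (A : Algorithm m w) : (bind k A).queries ≤ A.queries + q := by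
  induction A with
  | output x => exact (Finset.sup_le fun _ _ => hk x).trans (Nat.le_add_left _ _)
  | gate V next ih => exact ih
  | query next ih => simp only [bind, queries]; omega
  | measure next ih =>
    refine Finset.sup_le fun s _ => (ih s).trans (Nat.add_le_add_right ?_ q)
    exact Finset.le_sup (f := fun s => (next s).queries) (Finset.mem_univ s)

theorem exp_bind (hU : U ∈ Matrix.unitaryGroup (Fin (2 ^ m)) ℂ) (k : ℝ → Algorithm m w)
    (F : ℝ → ℝ) (A : Algorithm m w) :
    exp U F (bind k A) = exp U (fun x => exp U F (k x)) A := by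
  have hreset : ∀ s : Basis m w,
      (permGate (Equiv.swap s (0, 0, 0))).1.mulVec (ket s) = ket (0, 0, 0) := by
    intro s
    ext t
    rw [permGate_mulVec]
    simp only [ket, Pi.single_apply, Equiv.swap_apply_eq_iff, Equiv.swap_apply_left]
  have h : ∀ (A : Algorithm m w) ψ, normSq ψ = 1 →
      expFrom U F (bind k A) ψ = expFrom U (fun x => exp U F (k x)) A ψ := by
    intro A
    induction A with
    | output x =>
      intro ψ hψ
      simp only [bind, expFrom, hreset, ← Finset.sum_mul]
      rw [normSq] at hψ
      rw [hψ, one_mul, exp]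
    | gate V next ih => intro ψ hψ; exact ih _ (by rwa [normSq_mulVec V.2])
    | query next ih => intro ψ hψ; exact ih _ (by rwa [normSq_applyQuery hU])
    | measure next ih => intro ψ hψ; simp only [bind, expFrom, ih _ _ (normSq_ket _)]
  exact h A _ (normSq_ket _)

/-! ### Random choice -/

/-- A biased coin. -/
theorem exists_coin (m w : ℕ) {p : ℝ} (h0 : 0 ≤ p) (h1 : p ≤ 1) :
    ∃ A : Algorithm m w, A.queries = 0 ∧
      ∀ (U : Matrix (Fin (2 ^ m)) (Fin (2 ^ m)) ℂ) (F : ℝ → ℝ),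
        exp U F A = p * F 1 + (1 - p) * F 0 := by
  let v : State m w := fun s => if s.2 = (0, 0) then (if s.1 = 0 then (√p : ℂ) else √(1 - p)) else 0
  have hsum : ∀ g : Basis m w → ℝ,
      ∑ s, ‖v s‖ ^ 2 * g s = p * g (0, 0, 0) + (1 - p) * g (1, 0, 0) := by
    intro g
    have hz : ∀ (c : Fin 2) (y : Fin (2 ^ m) × Fin (2 ^ w)), y ≠ (0, 0) → v (c, y) = 0 :=
      fun c y hy => if_neg hy
    have hc : ∀ c : Fin 2, ∑ y, ‖v (c, y)‖ ^ 2 * g (c, y) = ‖v (c, 0, 0)‖ ^ 2 * g (c, 0, 0) :=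
      fun c => Finset.sum_eq_single _ (fun y _ hy => by simp [hz c y hy]) (by simp)
    rw [Fintype.sum_prod_type, Fin.sum_univ_two, hc, hc]
    simp [v, Real.sq_sqrt h0, Real.sq_sqrt (sub_nonneg.2 h1)]
  have hv : normSq v = 1 := by
    have := hsum fun _ => 1
    simp only [mul_one] at this
    rw [normSq, this]
    ring
  obtain ⟨V, hV⟩ := exists_unitary_mulVec_ket ((0, 0, 0) : Basis m w) v hv
  refine ⟨gate V (measure fun s => output (if s.1 = 0 then 1 else 0)), ?_, fun U F => ?_⟩
  · exact Nat.le_zero.1 (Finset.sup_le fun _ _ => le_rfl)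
  · simp only [exp, expFrom, hV]
    rw [hsum]
    simp

/-- A uniformly random element of a finite sequence. -/
theorem exists_uniform (m w n : ℕ) (x : ℕ → ℝ) :
    ∃ A : Algorithm m w, A.queries = 0 ∧
      ∀ U ∈ Matrix.unitaryGroup (Fin (2 ^ m)) ℂ, ∀ F : ℝ → ℝ,
        exp U F A = (∑ i ∈ Finset.range (n + 1), F (x i)) / (n + 1) := by
  induction n with
  | zero => exact ⟨output (x 0), rfl, fun U _ F => by simp [exp, expFrom]⟩
  | succ n ih =>
    obtain ⟨A, hA, hexp⟩ := ih
    have hn : (0 : ℝ) < n + 2 := by positivity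
    -- The newest of the `n + 2` elements is taken with probability `1/(n+2)`; otherwise the uniform
    -- choice among the others is used.
    obtain ⟨B, hB, hcoin⟩ := exists_coin m w (p := 1 / (n + 2 : ℝ)) (by positivity)
      ((div_le_one hn).2 (by linarith [(Nat.cast_nonneg n : (0 : ℝ) ≤ n)]))
    refine ⟨bind (fun y => if y = 1 then output (x (n + 1)) else A) B, ?_, fun U hU F => ?_⟩
    · refine Nat.le_zero.1 ((queries_bind_le (q := 0) (fun y => ?_) B).trans (by rw [hB]))
      split_ifs
      · exact le_rfl
      · exact hA.le
    · rw [exp_bind hU, hcoin, Finset.sum_range_succ, if_pos rfl, if_neg zero_ne_one, hexp U hU]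
      simp only [exp, expFrom]
      push_cast
      field_simp
      ring

end Algorithm
end
end QuantumQuery

namespace QuantumQuery

noncomputable section

/-! ### The discrete Fourier transform and the sine window -/

/-- The `D`-th root of unity with the smallest positive argument. -/
def rootOfUnity (D : ℕ) : ℂ := Complex.exp (2 * Real.pi * Complex.I / D)

theorem norm_rootOfUnity (D : ℕ) : ‖rootOfUnity D‖ = 1 := by
  have : (2 * Real.pi * Complex.I / D : ℂ) = ((2 * Real.pi / D : ℝ) : ℂ) * Complex.I := by
    push_cast; ring
  rw [rootOfUnity, this, Complex.norm_exp_ofReal_mul_I]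

theorem rootOfUnity_ne_zero (D : ℕ) : rootOfUnity D ≠ 0 := Complex.exp_ne_zero _

theorem star_rootOfUnity (D : ℕ) : star (rootOfUnity D) = (rootOfUnity D)⁻¹ :=
  (Complex.inv_eq_conj (norm_rootOfUnity D)).symm

theorem rootOfUnity_pow (D : ℕ) [NeZero D] : rootOfUnity D ^ D = 1 :=
  (Complex.isPrimitiveRoot_exp D (NeZero.ne D)).pow_eq_one

/-- The discrete Fourier transform. -/
def dft (D : ℕ) [NeZero D] : Matrix.unitaryGroup (Fin D) ℂ :=
  ⟨Matrix.of fun t j => (rootOfUnity D)⁻¹ ^ (t.val * j.val) / (√D : ℂ), by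
    have hD : (√D : ℂ) * √D = D := by
      rw [← Complex.ofReal_mul, Real.mul_self_sqrt (Nat.cast_nonneg D), Complex.ofReal_natCast]
    have hD0 : (D : ℂ) ≠ 0 := Nat.cast_ne_zero.2 (NeZero.ne D)
    rw [Matrix.mem_unitaryGroup_iff]
    ext t s
    have hterm : ∀ j : Fin D, (Matrix.of fun t j : Fin D =>
        (rootOfUnity D)⁻¹ ^ (t.val * j.val) / (√D : ℂ)) t j * star (Matrix.of fun t j : Fin D =>
        (rootOfUnity D)⁻¹ ^ (t.val * j.val) / (√D : ℂ)) j s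
        = (rootOfUnity D ^ s.val / rootOfUnity D ^ t.val) ^ j.val / D := by
      intro j
      have h1 : star ((√D : ℂ)) = √D := Complex.conj_ofReal _
      rw [Matrix.star_apply, Matrix.of_apply, Matrix.of_apply, star_div₀, star_pow, h1, star_inv₀,
        star_rootOfUnity, inv_inv, div_mul_div_comm, hD, div_pow, ← pow_mul, ← pow_mul, inv_pow,
        mul_comm, div_eq_mul_inv (rootOfUnity D ^ _)]
    rw [Matrix.mul_apply, Finset.sum_congr rfl fun j _ => hterm j, ← Finset.sum_div,
      Fin.sum_univ_eq_sum_range fun j => (rootOfUnity D ^ s.val / rootOfUnity D ^ t.val) ^ j]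
    by_cases hts : t = s
    · subst hts
      simp [div_self (pow_ne_zero _ (rootOfUnity_ne_zero D)), hD0]
    · have hne : rootOfUnity D ^ s.val / rootOfUnity D ^ t.val ≠ 1 := by
        rw [Ne, div_eq_one_iff_eq (pow_ne_zero _ (rootOfUnity_ne_zero D))]
        exact fun h => hts (Fin.ext ((Complex.isPrimitiveRoot_exp D (NeZero.ne D)).pow_inj
          s.2 t.2 h).symm)
      rw [geom_sum_eq hne, div_pow, ← pow_mul, ← pow_mul, mul_comm, pow_mul, mul_comm t.val,
        pow_mul, rootOfUnity_pow, Matrix.one_apply_ne hts]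
      simp⟩

theorem dft_mulVec_shift (D : ℕ) [NeZero D] (b : Fin D → ℂ) (t : Fin D) :
    (dft D).1.mulVec (fun j => b (j + 1)) t = rootOfUnity D ^ t.val * (dft D).1.mulVec b t := by
  have h : ∀ j : Fin D, (dft D).1 t j = rootOfUnity D ^ t.val * (dft D).1 t (j + 1) := by
    intro j
    have hp : ((rootOfUnity D)⁻¹ ^ t.val) ^ D = 1 := by
      rw [← pow_mul, mul_comm, pow_mul, inv_pow, rootOfUnity_pow, inv_one, one_pow]
    have : ((rootOfUnity D)⁻¹ ^ t.val) ^ (j + 1 : Fin D).val =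
        ((rootOfUnity D)⁻¹ ^ t.val) ^ (j.val + 1) := by
      rw [Fin.val_add, ← pow_eq_pow_mod _ hp, pow_add, Fin.val_one', ← pow_eq_pow_mod _ hp,
        ← pow_add]
    change (_ : ℂ) / (_ : ℂ) = _ * ((_ : ℂ) / (_ : ℂ))
    rw [pow_mul, pow_mul, this, pow_succ, inv_pow]
    field_simp [pow_ne_zero t.val (rootOfUnity_ne_zero D)]
  simp only [Matrix.mulVec, dotProduct, Finset.mul_sum]
  rw [← Equiv.sum_comp (Equiv.addRight (1 : Fin D)) fun j => rootOfUnity D ^ t.val * ((dft D).1 t j * b j)]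
  exact Finset.sum_congr rfl fun j _ => by rw [h j, mul_assoc]; rfl

/-- `sin (j x)` is an eigenvector of the second difference with eigenvalue `2 (1 - cos x)`, so
summation by parts leaves a boundary term, which vanishes for `x = π/n`. -/
theorem sum_sq_sub_sin (x : ℝ) (n : ℕ) :
    ∑ j ∈ Finset.range n, (Real.sin ((j + 1) * x) - Real.sin (j * x)) ^ 2 =
      2 * (1 - Real.cos x) * ∑ j ∈ Finset.range n, Real.sin (j * x) ^ 2 +
        Real.sin (n * x) * (Real.sin (n * x) - Real.sin ((n - 1) * x)) := by
  induction n with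
  | zero => simp
  | succ n ih =>
    rw [Finset.sum_range_succ, Finset.sum_range_succ, ih]
    push_cast
    have h1 : Real.sin ((n + 1) * x) =
        Real.sin (n * x) * Real.cos x + Real.cos (n * x) * Real.sin x := by
      rw [add_mul, one_mul, Real.sin_add]
    have h2 : Real.sin ((n - 1) * x) =
        Real.sin (n * x) * Real.cos x - Real.cos (n * x) * Real.sin x := by
      rw [sub_mul, one_mul, Real.sin_sub]
    rw [add_sub_cancel_right, h1, h2]
    ring

/-- The sine window on `{0, …, D - 1}`, as a unit vector. -/
def sineWindow (D : ℕ) (j : ℕ) : ℝ :=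
  Real.sin (j * (Real.pi / D)) / √(∑ i ∈ Finset.range D, Real.sin (i * (Real.pi / D)) ^ 2)

theorem sum_sin_sq_pos {D : ℕ} (hD : 2 ≤ D) :
    0 < ∑ i ∈ Finset.range D, Real.sin (i * (Real.pi / D)) ^ 2 := by
  refine Finset.sum_pos' (fun _ _ => sq_nonneg _) ⟨1, Finset.mem_range.2 hD, ?_⟩
  have hD' : (2 : ℝ) ≤ D := by exact_mod_cast hD
  refine pow_pos (Real.sin_pos_of_pos_of_lt_pi ?_ ?_) 2
  · simpa using div_pos Real.pi_pos (by linarith)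
  · rw [Nat.cast_one, one_mul]
    exact div_lt_self Real.pi_pos (by linarith)

theorem sum_sineWindow_sq {D : ℕ} (hD : 2 ≤ D) :
    ∑ j : Fin D, sineWindow D j ^ 2 = 1 := by
  rw [Fin.sum_univ_eq_sum_range fun j => sineWindow D j ^ 2]
  simp only [sineWindow, div_pow, Real.sq_sqrt (sum_sin_sq_pos hD).le]
  rw [← Finset.sum_div, div_self (sum_sin_sq_pos hD).ne']

theorem sum_sineWindow_sub_sq {D : ℕ} (hD : 2 ≤ D) :
    ∑ j : Fin D, (sineWindow D (j + 1) - sineWindow D j) ^ 2 = 2 * (1 - Real.cos (Real.pi / D)) := by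
  have hD' : (D : ℝ) ≠ 0 := by positivity
  rw [Fin.sum_univ_eq_sum_range fun j => (sineWindow D (j + 1) - sineWindow D j) ^ 2]
  simp only [sineWindow, ← sub_div, div_pow, Real.sq_sqrt (sum_sin_sq_pos hD).le]
  rw [← Finset.sum_div]
  push_cast
  rw [sum_sq_sub_sin, mul_div_cancel₀ _ hD', Real.sin_pi, zero_mul, add_zero,
    mul_div_assoc, div_self (sum_sin_sq_pos hD).ne', mul_one]

/-- A cyclic shift multiplies the coefficient at `t` by the `t`-th power of the root of unity. So
the sum is the squared norm of the transform of "shift of `b` minus `z b`", and Parseval reduces it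
to the differences of the window. -/
theorem sum_norm_sub_sq_mul_dft_sineWindow {D : ℕ} [NeZero D] (hD : 2 ≤ D) {z : ℂ} (hz : ‖z‖ = 1) :
    ∑ t : Fin D, ‖rootOfUnity D ^ t.val - z‖ ^ 2 *
        ‖(dft D).1.mulVec (fun j => sineWindow D j * z ^ j.val) t‖ ^ 2 =
      2 * (1 - Real.cos (Real.pi / D)) := by
  have hD' : (D : ℝ) ≠ 0 := by positivity
  set b : Fin D → ℂ := fun j => sineWindow D j * z ^ j.val with hb
  have h1 : ∀ t, (rootOfUnity D ^ t.val - z) * (dft D).1.mulVec b t =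
      (dft D).1.mulVec ((fun j => b (j + 1)) - z • b) t := by
    intro t
    rw [Matrix.mulVec_sub, Matrix.mulVec_smul, Pi.sub_apply, dft_mulVec_shift, Pi.smul_apply,
      smul_eq_mul]
    ring
  have h2 : ∀ j : Fin D, ‖b (j + 1) - z * b j‖ ^ 2 =
      (sineWindow D (j + 1) - sineWindow D j) ^ 2 := by
    intro j
    have : b (j + 1) = sineWindow D (j + 1) * z ^ (j.val + 1) := by
      rcases Nat.lt_or_ge (j.val + 1) D with h | h
      · have hv : (j + 1 : Fin D).val = j.val + 1 := by
          rw [Fin.val_add, Fin.val_one', Nat.mod_eq_of_lt (by omega : 1 < D), Nat.mod_eq_of_lt h]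
        simp only [hb, hv]
      -- At the wrap-around `z ^ D` need not be `1`; this is harmless since the window vanishes at
      -- both `0` and `D`.
      · have hj : j.val + 1 = D := le_antisymm j.2 h
        have hv : (j + 1 : Fin D).val = 0 := by
          rw [Fin.val_add, Fin.val_one', Nat.mod_eq_of_lt (by omega : 1 < D), hj, Nat.mod_self]
        simp only [hb, hv, hj, sineWindow, mul_div_cancel₀ _ hD', Real.sin_pi]
        simp
    have h3 : b (j + 1) - z * b j =
        ((sineWindow D (j + 1) - sineWindow D j : ℝ) : ℂ) * z ^ (j.val + 1) := by
      rw [this, hb]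
      push_cast
      ring
    rw [h3, norm_mul, norm_pow, hz, one_pow, mul_one, Complex.norm_real, Real.norm_eq_abs, sq_abs]
  simp only [← mul_pow, ← norm_mul, h1]
  rw [← sum_sineWindow_sub_sq hD]
  exact (normSq_mulVec (dft D).2 _).trans (Finset.sum_congr rfl fun j _ => h2 j)

/-- The chord has length `2 |sin (x - y)|`, and `|sin x| ≤ |sin (x - y)| + |sin y|` by the addition
formula. -/
theorem sq_abs_sin_sub_abs_sin_le (x y : ℝ) :
    (|Real.sin x| - |Real.sin y|) ^ 2 ≤
      ‖Complex.exp (2 * x * Complex.I) - Complex.exp (2 * y * Complex.I)‖ ^ 2 / 4 := by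
  have h1 : Complex.exp (2 * x * Complex.I) - Complex.exp (2 * y * Complex.I) =
      Complex.exp ((2 * y : ℝ) * Complex.I) *
        (Complex.exp (Complex.I * ((2 * (x - y) : ℝ) : ℂ)) - 1) := by
    rw [mul_sub, ← Complex.exp_add]
    push_cast
    ring_nf
  have h2 : ‖Complex.exp (2 * x * Complex.I) - Complex.exp (2 * y * Complex.I)‖ ^ 2 / 4 =
      |Real.sin (x - y)| ^ 2 := by
    rw [h1, norm_mul, Complex.norm_exp_ofReal_mul_I, one_mul, Complex.norm_exp_I_mul_ofReal_sub_one,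
      mul_div_cancel_left₀ _ two_ne_zero, Real.norm_eq_abs, abs_mul, abs_two]
    ring
  have key : ∀ a b : ℝ, |Real.sin a| ≤ |Real.sin (a - b)| + |Real.sin b| := by
    intro a b
    calc |Real.sin a| = |Real.sin (a - b) * Real.cos b + Real.cos (a - b) * Real.sin b| := by
          rw [← Real.sin_add, sub_add_cancel]
      _ ≤ |Real.sin (a - b)| * |Real.cos b| + |Real.cos (a - b)| * |Real.sin b| := by
          rw [← abs_mul, ← abs_mul]
          exact abs_add_le _ _
      _ ≤ _ := add_le_add (mul_le_of_le_one_right (abs_nonneg _) (Real.abs_cos_le_one _))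
          (mul_le_of_le_one_left (abs_nonneg _) (Real.abs_cos_le_one _))
  rw [h2]
  refine sq_le_sq' ?_ ?_
  · have := key y x
    rw [← neg_sub x y, Real.sin_neg, abs_neg] at this
    linarith
  · linarith [key x y]

/-- Phase estimation with the sine window: the mean square error of `|sin (π t / D)|` as an
estimate of `|sin θ|`. -/
theorem sum_sq_sub_abs_sin_mul_dft_le {D : ℕ} [NeZero D] (hD : 2 ≤ D) (θ : ℝ) :
    ∑ t : Fin D, (|Real.sin (t * (Real.pi / D))| - |Real.sin θ|) ^ 2 *
        ‖(dft D).1.mulVec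
          (fun j => sineWindow D j * Complex.exp ((2 * j + 1) * θ * Complex.I)) t‖ ^ 2 ≤
      (1 - Real.cos (Real.pi / D)) / 2 := by
  set z := Complex.exp (2 * θ * Complex.I) with hzdef
  have hz : ‖z‖ = 1 := by
    rw [hzdef, show (2 * θ * Complex.I : ℂ) = ((2 * θ : ℝ) : ℂ) * Complex.I by push_cast; ring,
      Complex.norm_exp_ofReal_mul_I]
  have hvec : (fun j : Fin D =>
      (sineWindow D j : ℂ) * Complex.exp ((2 * j + 1) * θ * Complex.I)) =
      Complex.exp (θ * Complex.I) • fun j : Fin D => (sineWindow D j : ℂ) * z ^ j.val := by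
    ext j
    rw [Pi.smul_apply, smul_eq_mul, hzdef, ← Complex.exp_nat_mul, mul_left_comm,
      ← Complex.exp_add]
    ring_nf
  have hle := sum_norm_sub_sq_mul_dft_sineWindow hD hz
  have hpt : ∀ t : Fin D, (|Real.sin (t * (Real.pi / D))| - |Real.sin θ|) ^ 2 ≤
      ‖rootOfUnity D ^ t.val - z‖ ^ 2 / 4 := by
    intro t
    have h := sq_abs_sin_sub_abs_sin_le (t * (Real.pi / D)) θ
    rw [rootOfUnity, ← Complex.exp_nat_mul]
    convert h using 5
    push_cast
    ring_nf
  calc _ ≤ ∑ t : Fin D, ‖rootOfUnity D ^ t.val - z‖ ^ 2 / 4 *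
        ‖(dft D).1.mulVec (fun j => sineWindow D j * z ^ j.val) t‖ ^ 2 := by
        refine Finset.sum_le_sum fun t _ => ?_
        rw [hvec, Matrix.mulVec_smul, Pi.smul_apply, norm_smul, Complex.norm_exp_ofReal_mul_I,
          one_mul]
        exact mul_le_mul_of_nonneg_right (hpt t) (sq_nonneg _)
    _ = (1 - Real.cos (Real.pi / D)) / 2 := by
        simp only [div_mul_eq_mul_div]
        rw [← Finset.sum_div, hle]
        ring

end
end QuantumQuery

namespace QuantumQuery

noncomputable section

/-! ### Vectors supported on the items -/

variable {N : ℕ}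

theorem item_injective : Function.Injective (item (N := N)) :=
  Fin.castLE_injective (Nat.le_pow_clog one_lt_two N)

/-- The vector on the data register with amplitudes `v` on the items, and `0` elsewhere. -/
def onItems (v : Fin N → ℂ) : Fin (2 ^ dataQubits N) → ℂ := Function.extend item v 0

theorem onItems_item (v : Fin N → ℂ) (z : Fin N) : onItems v (item z) = v z :=
  item_injective.extend_apply _ _ _

theorem onItems_of_notMem (v : Fin N → ℂ) {x : Fin (2 ^ dataQubits N)}
    (hx : x ∉ Set.range (item (N := N))) : onItems v x = 0 :=
  Function.extend_apply' _ _ _ hx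

theorem sum_items {M : Type} [AddCommMonoid M] (g : Fin (2 ^ dataQubits N) → M)
    (hg : ∀ x, x ∉ Set.range (item (N := N)) → g x = 0) : ∑ x, g x = ∑ z : Fin N, g (item z) :=
  (Fintype.sum_of_injective item item_injective _ g hg fun _ => rfl).symm

theorem normSq_onItems (v : Fin N → ℂ) : normSq (onItems v) = normSq v := by
  rw [normSq, sum_items _ fun x hx => by simp [onItems_of_notMem v hx]]
  simp only [onItems_item]
  rfl

theorem onItems_eq_sum (v : Fin N → ℂ) : onItems v = ∑ z, v z • ket (item z) := by
  ext x
  rw [Finset.sum_apply]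
  by_cases hx : x ∈ Set.range (item (N := N))
  · obtain ⟨y, rfl⟩ := hx
    simp [onItems_item, ket, Pi.single_apply, item_injective.eq_iff]
  · rw [onItems_of_notMem v hx, Finset.sum_eq_zero]
    intro z _
    have : x ≠ item z := fun h => hx ⟨z, h.symm⟩
    simp [ket, this]

theorem IsMembershipOracle.mulVec_onItems {f : Fin N → Bool}
    {U : Matrix (Fin (2 ^ dataQubits N)) (Fin (2 ^ dataQubits N)) ℂ} (hU : IsMembershipOracle f U)
    (v : Fin N → ℂ) : U.mulVec (onItems v) = onItems fun z => (-1) ^ (f z).toNat * v z := by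
  rw [onItems_eq_sum, onItems_eq_sum, Matrix.mulVec_sum]
  refine Finset.sum_congr rfl fun z _ => ?_
  rw [Matrix.mulVec_smul, hU.2 z, smul_smul, mul_comm]

/-- The uniform superposition of the items. -/
def uniformItems (N : ℕ) : Fin (2 ^ dataQubits N) → ℂ := onItems fun _ => ((1 / √N : ℝ) : ℂ)

/-- The reflection about the uniform superposition of the items. -/
def diffusion (N : ℕ) : Matrix (Fin (2 ^ dataQubits N)) (Fin (2 ^ dataQubits N)) ℂ :=
  (2 : ℂ) • Matrix.vecMulVec (uniformItems N) (uniformItems N) - 1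

theorem diffusion_mulVec (v : Fin (2 ^ dataQubits N) → ℂ) :
    (diffusion N).mulVec v = (2 * (uniformItems N ⬝ᵥ v)) • uniformItems N - v := by
  rw [diffusion, Matrix.sub_mulVec, Matrix.smul_mulVec, Matrix.one_mulVec,
    Matrix.vecMulVec_mulVec, op_smul_eq_smul, mul_smul]

theorem uniformItems_dotProduct (v : Fin N → ℂ) :
    uniformItems N ⬝ᵥ onItems v = ((1 / √N : ℝ) : ℂ) * ∑ z, v z := by
  rw [dotProduct, sum_items _ fun x hx => by rw [onItems_of_notMem v hx, mul_zero], Finset.mul_sum]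
  simp only [uniformItems, onItems_item]

theorem sqrt_mul_inv_sqrt_sq (hN : 1 ≤ N) : (N : ℝ) * (1 / √N * (1 / √N)) = 1 := by
  have : (0 : ℝ) < N := by exact_mod_cast hN
  rw [div_mul_div_comm, Real.mul_self_sqrt this.le, one_mul, mul_one_div_cancel this.ne']

theorem uniformItems_dotProduct_self (hN : 1 ≤ N) : uniformItems N ⬝ᵥ uniformItems N = 1 := by
  have := sqrt_mul_inv_sqrt_sq hN
  refine (uniformItems_dotProduct _).trans ?_
  rw [Finset.sum_const, Finset.card_univ, Fintype.card_fin, nsmul_eq_mul, mul_left_comm]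
  exact_mod_cast this

theorem normSq_uniformItems (hN : 1 ≤ N) : normSq (uniformItems N) = 1 := by
  rw [uniformItems, normSq_onItems, normSq, Finset.sum_const, Finset.card_univ, Fintype.card_fin,
    nsmul_eq_mul, Complex.norm_real, Real.norm_eq_abs, sq_abs, sq]
  exact sqrt_mul_inv_sqrt_sq hN

theorem diffusion_mem_unitaryGroup (hN : 1 ≤ N) :
    diffusion N ∈ Matrix.unitaryGroup (Fin (2 ^ dataQubits N)) ℂ := by
  have hreal : ∀ x, star (uniformItems N x) = uniformItems N x := by
    intro x
    by_cases hx : x ∈ Set.range (item (N := N))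
    · obtain ⟨y, rfl⟩ := hx
      rw [uniformItems, onItems_item]
      exact Complex.conj_ofReal _
    · rw [uniformItems, onItems_of_notMem _ hx, star_zero]
  have hs : star (diffusion N) = diffusion N := by
    ext x y
    have h2 : star (2 : ℂ) = 2 := Complex.conj_ofNat 2
    have h1 : star ((1 : Matrix (Fin (2 ^ dataQubits N)) (Fin (2 ^ dataQubits N)) ℂ) y x) =
        (1 : Matrix _ _ ℂ) x y := by
      rw [Matrix.one_apply, Matrix.one_apply, apply_ite star, star_one, star_zero]
      simp only [eq_comm]
    simp only [diffusion, Matrix.star_apply, Matrix.sub_apply, Matrix.smul_apply,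
      Matrix.vecMulVec_apply, smul_eq_mul, star_sub, star_mul', hreal, h2, h1]
    rw [mul_comm (uniformItems N y)]
  rw [Matrix.mem_unitaryGroup_iff, hs]
  refine Matrix.mulVec_injective (funext fun v => ?_)
  rw [← Matrix.mulVec_mulVec, diffusion_mulVec, diffusion_mulVec, dotProduct_sub,
    dotProduct_smul, uniformItems_dotProduct_self hN, Matrix.one_mulVec, smul_eq_mul, mul_one]
  module

/-! ### Amplitude amplification -/

/-- The amplitude of the item `z` after `k` Grover iterations. -/
def groverAmplitude (f : Fin N → Bool) (K : ℕ) (θ : ℝ) (k : ℕ) (z : Fin N) : ℂ :=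
  if f z then ((Real.sin ((2 * k + 1) * θ) / √K : ℝ) : ℂ)
  else ((Real.cos ((2 * k + 1) * θ) / √(N - K) : ℝ) : ℂ)

theorem sum_ite_eq_card {R : Type} [CommRing R] (f : Fin N → Bool) (a b : R) :
    ∑ z, (if f z then a else b) =
      (Finset.univ.filter fun z => f z = true).card * a +
        (N - (Finset.univ.filter fun z => f z = true).card) * b := by
  have h : ((Finset.univ.filter fun z => f z = true).card : R) +
      (Finset.univ.filter fun z => ¬ f z = true).card = N := by
    rw [← Nat.cast_add, Finset.card_filter_add_card_filter_not, Finset.card_univ, Fintype.card_fin]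
  rw [Finset.sum_ite, Finset.sum_const, Finset.sum_const, nsmul_eq_mul, nsmul_eq_mul, ← h]
  ring

/-- The angle of Grover iterations with `K` marked items out of `N`. -/
def groverAngle (N K : ℕ) : ℝ := Real.arcsin (√K / √N)

theorem sqrt_mul_sin_groverAngle {K : ℕ} (hN : 1 ≤ N) (hK : K ≤ N) :
    √N * Real.sin (groverAngle N K) = √K := by
  have hN0 : 0 < √(N : ℝ) := Real.sqrt_pos.2 (by exact_mod_cast hN)
  rw [groverAngle, Real.sin_arcsin, mul_div_cancel₀ _ hN0.ne']
  · linarith [div_nonneg (Real.sqrt_nonneg (K : ℝ)) hN0.le]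
  · exact (div_le_one hN0).2 (Real.sqrt_le_sqrt (by exact_mod_cast hK))

theorem sqrt_mul_cos_groverAngle {K : ℕ} (hN : 1 ≤ N) :
    √N * Real.cos (groverAngle N K) = √(N - K) := by
  have hN0 : (0 : ℝ) < N := by exact_mod_cast hN
  rw [groverAngle, Real.cos_arcsin, ← Real.sqrt_mul hN0.le, div_pow,
    Real.sq_sqrt (Nat.cast_nonneg K), Real.sq_sqrt hN0.le, mul_sub, mul_one,
    mul_div_cancel₀ _ hN0.ne']

section Amplitudes

variable {f : Fin N → Bool} {K : ℕ}

theorem onItems_groverAmplitude_zero (hN : 1 ≤ N)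
    (hK : K = (Finset.univ.filter fun x => f x = true).card) :
    onItems (groverAmplitude f K (groverAngle N K) 0) = uniformItems N := by
  have hN0 : 0 < √(N : ℝ) := Real.sqrt_pos.2 (by exact_mod_cast hN)
  have hKN : K ≤ N := by
    rw [hK]; exact (Finset.card_le_univ _).trans_eq (Fintype.card_fin N)
  rw [uniformItems]
  congr 1
  ext z
  simp only [groverAmplitude, Nat.cast_zero, mul_zero, zero_add, one_mul]
  by_cases hz : f z = true
  · have hK0 : 0 < √(K : ℝ) := by
      refine Real.sqrt_pos.2 (Nat.cast_pos.2 ?_)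
      rw [hK]
      exact Finset.card_pos.2 ⟨z, by simpa using hz⟩
    rw [if_pos hz, ← sqrt_mul_sin_groverAngle hN hKN] at *
    have : Real.sin (groverAngle N K) ≠ 0 := (pos_of_mul_pos_right hK0 hN0.le).ne'
    congr 1
    field_simp
  · have hK0 : 0 < √((N : ℝ) - K) := by
      refine Real.sqrt_pos.2 (sub_pos.2 (Nat.cast_lt.2 ?_))
      rw [hK]
      refine (Finset.card_lt_univ_of_notMem (x := z) ?_).trans_eq (Fintype.card_fin N)
      simpa using hz
    rw [if_neg hz, ← sqrt_mul_cos_groverAngle hN] at *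
    have : Real.cos (groverAngle N K) ≠ 0 := (pos_of_mul_pos_right hK0 hN0.le).ne'
    congr 1
    field_simp

/-- With `φ = (2k+2)θ`, the overlap of the sign-flipped state with the uniform one is `cos φ`.
Reflecting then uses `2 cos φ sin θ + sin (φ - θ) = sin (φ + θ)` on marked items and the analogous
cosine identity on the others. -/
theorem diffusion_mulVec_oracle_mulVec (hN : 1 ≤ N)
    (hK : K = (Finset.univ.filter fun x => f x = true).card)
    {U : Matrix (Fin (2 ^ dataQubits N)) (Fin (2 ^ dataQubits N)) ℂ} (hU : IsMembershipOracle f U)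
    (k : ℕ) :
    (diffusion N).mulVec (U.mulVec (onItems (groverAmplitude f K (groverAngle N K) k))) =
      onItems (groverAmplitude f K (groverAngle N K) (k + 1)) := by
  have hN0 : 0 < √(N : ℝ) := Real.sqrt_pos.2 (by exact_mod_cast hN)
  have hKN : K ≤ N := by
    rw [hK]; exact (Finset.card_le_univ _).trans_eq (Fintype.card_fin N)
  set θ := groverAngle N K with hθ
  have hs := sqrt_mul_sin_groverAngle hN hKN
  have hc := sqrt_mul_cos_groverAngle (K := K) hN
  rw [← hθ] at hs hc
  have hflip : ∀ z, (-1 : ℂ) ^ (f z).toNat * groverAmplitude f K θ k z =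
      if f z then ((-(Real.sin ((2 * k + 1) * θ) / √K) : ℝ) : ℂ)
      else ((Real.cos ((2 * k + 1) * θ) / √(N - K) : ℝ) : ℂ) := by
    intro z
    cases hz : f z <;> simp [groverAmplitude, hz]
  have hsum : 1 / √N * ((K : ℝ) * -(Real.sin ((2 * k + 1) * θ) / √K) +
      (N - K) * (Real.cos ((2 * k + 1) * θ) / √(N - K))) = Real.cos ((2 * k + 2) * θ) := by
    have h1 : ∀ x a : ℝ, 0 ≤ x → x * (a / √x) = √x * a := by
      intro x a hx
      rw [mul_div_left_comm, Real.div_sqrt, mul_comm]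
    rw [mul_neg, h1 _ _ (Nat.cast_nonneg K), h1 _ _ (sub_nonneg.2 (Nat.cast_le.2 hKN)), ← hs, ← hc,
      show (2 * k + 2) * θ = (2 * k + 1) * θ + θ by ring, Real.cos_add]
    field_simp
    ring
  rw [hU.mulVec_onItems, diffusion_mulVec, uniformItems_dotProduct]
  simp only [hflip]
  rw [sum_ite_eq_card f, ← hK]
  have hsum' := congrArg (fun r : ℝ => (r : ℂ)) hsum
  push_cast at hsum'
  push_cast
  rw [hsum', onItems_eq_sum, onItems_eq_sum, uniformItems, onItems_eq_sum, Finset.smul_sum,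
    ← Finset.sum_sub_distrib]
  refine Finset.sum_congr rfl fun z _ => ?_
  rw [smul_smul, ← sub_smul]
  congr 1
  have e1 : (2 * ((k + 1 : ℕ) : ℝ) + 1) * θ = (2 * k + 2) * θ + θ := by push_cast; ring
  have e2 : (2 * (k : ℝ) + 1) * θ = (2 * k + 2) * θ - θ := by ring
  by_cases hz : f z = true
  · have hK0 : 0 < √(K : ℝ) := by
      refine Real.sqrt_pos.2 (Nat.cast_pos.2 ?_)
      rw [hK]
      exact Finset.card_pos.2 ⟨z, by simpa using hz⟩
    rw [if_pos hz, groverAmplitude, if_pos hz, e1, Real.sin_add]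
    rw [← hs] at hK0 ⊢
    have : Real.sin θ ≠ 0 := (pos_of_mul_pos_right hK0 hN0.le).ne'
    have key : 2 * Real.cos ((2 * k + 2) * θ) * (1 / √N) -
        -(Real.sin ((2 * k + 1) * θ) / (√N * Real.sin θ)) =
        (Real.sin ((2 * k + 2) * θ) * Real.cos θ + Real.cos ((2 * k + 2) * θ) * Real.sin θ) /
          (√N * Real.sin θ) := by
      rw [e2, Real.sin_sub]
      field_simp
      ring
    rw [← key]
    push_cast
    rfl
  · have hK0 : 0 < √((N : ℝ) - K) := by
      refine Real.sqrt_pos.2 (sub_pos.2 (Nat.cast_lt.2 ?_))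
      rw [hK]
      refine (Finset.card_lt_univ_of_notMem (x := z) ?_).trans_eq (Fintype.card_fin N)
      simpa using hz
    rw [if_neg hz, groverAmplitude, if_neg hz, e1, Real.cos_add]
    rw [← hc] at hK0 ⊢
    have : Real.cos θ ≠ 0 := (pos_of_mul_pos_right hK0 hN0.le).ne'
    have key : 2 * Real.cos ((2 * k + 2) * θ) * (1 / √N) -
        (Real.cos ((2 * k + 1) * θ) / (√N * Real.cos θ)) =
        (Real.cos ((2 * k + 2) * θ) * Real.cos θ - Real.sin ((2 * k + 2) * θ) * Real.sin θ) /
          (√N * Real.cos θ) := by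
      rw [e2, Real.cos_sub]
      field_simp
      ring
    rw [← key]
    push_cast
    rfl

/-- A measurement of a superposition of powers of Grover iterations, decomposed into the two
eigenspaces of the iteration. -/
theorem sum_norm_sq_groverAmplitude_le (hK : K = (Finset.univ.filter fun x => f x = true).card)
    {ι : Type} [Fintype ι] (θ : ℝ) (c : ι → ℂ) (e : ι → ℕ) :
    ∑ z, ‖∑ j, c j * groverAmplitude f K θ (e j) z‖ ^ 2 ≤
      (‖∑ j, c j * Complex.exp ((2 * e j + 1) * (θ : ℝ) * Complex.I)‖ ^ 2 +
        ‖∑ j, c j * Complex.exp ((2 * e j + 1) * ((-θ : ℝ) : ℂ) * Complex.I)‖ ^ 2) / 2 := by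
  have hKN : K ≤ N := by
    rw [hK]; exact (Finset.card_le_univ _).trans_eq (Fintype.card_fin N)
  set A := ∑ j, c j * Complex.sin ((2 * e j + 1) * θ) with hA
  set B := ∑ j, c j * Complex.cos ((2 * e j + 1) * θ) with hB
  have hplus : ∑ j, c j * Complex.exp ((2 * e j + 1) * (θ : ℝ) * Complex.I) = B + A * Complex.I := by
    rw [hA, hB, Finset.sum_mul, ← Finset.sum_add_distrib]
    refine Finset.sum_congr rfl fun j _ => ?_
    rw [Complex.exp_mul_I]
    ring
  have hminus : ∑ j, c j * Complex.exp ((2 * e j + 1) * ((-θ : ℝ) : ℂ) * Complex.I) =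
      B - A * Complex.I := by
    rw [hA, hB, Finset.sum_mul, ← Finset.sum_sub_distrib]
    refine Finset.sum_congr rfl fun j _ => ?_
    rw [Complex.exp_mul_I, Complex.ofReal_neg, mul_neg, Complex.sin_neg, Complex.cos_neg]
    ring
  have hsum : ∀ z, ‖∑ j, c j * groverAmplitude f K θ (e j) z‖ ^ 2 =
      if f z then ‖A‖ ^ 2 / K else ‖B‖ ^ 2 / (N - K) := by
    intro z
    cases hz : f z
    · have : ∑ j, c j * groverAmplitude f K θ (e j) z = B / (√((N : ℝ) - K) : ℂ) := by
        rw [hB, Finset.sum_div]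
        refine Finset.sum_congr rfl fun j _ => ?_
        simp [groverAmplitude, hz, mul_div_assoc]
      rw [this, norm_div, div_pow, Complex.norm_real, Real.norm_eq_abs, sq_abs,
        Real.sq_sqrt (sub_nonneg.2 (Nat.cast_le.2 hKN))]
      simp
    · have : ∑ j, c j * groverAmplitude f K θ (e j) z = A / (√(K : ℝ) : ℂ) := by
        rw [hA, Finset.sum_div]
        refine Finset.sum_congr rfl fun j _ => ?_
        simp [groverAmplitude, hz, mul_div_assoc]
      rw [this, norm_div, div_pow, Complex.norm_real, Real.norm_eq_abs, sq_abs,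
        Real.sq_sqrt (Nat.cast_nonneg K)]
      simp
  have htotal : ∑ z, ‖∑ j, c j * groverAmplitude f K θ (e j) z‖ ^ 2 =
      K * (‖A‖ ^ 2 / K) + (N - K) * (‖B‖ ^ 2 / (N - K)) := by
    have h := sum_ite_eq_card f (‖A‖ ^ 2 / K) (‖B‖ ^ 2 / (N - K))
    rw [← hK] at h
    simp only [hsum]
    exact h
  -- Only an inequality, because `x = 0` occurs when no item or every item is marked.
  have hmul : ∀ x a : ℝ, 0 ≤ a → x * (a / x) ≤ a := by
    intro x a ha
    by_cases hx : x = 0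
    · simpa [hx] using ha
    · rw [mul_div_cancel₀ _ hx]
  have hpar := parallelogram_law_with_norm ℝ B (A * Complex.I)
  rw [norm_mul, Complex.norm_I, mul_one] at hpar
  rw [htotal, hplus, hminus]
  linarith [hmul K (‖A‖ ^ 2) (sq_nonneg _), hmul (N - K) (‖B‖ ^ 2) (sq_nonneg _)]

end Amplitudes

/-! ### Estimation of the square root of the number of marked items -/

/-- Flip the control qubit if the workspace holds the number `i + 1`. -/
def flipPerm (m w i : ℕ) : Equiv.Perm (Basis m w) :=
  Function.Involutive.toPerm (fun s => (if s.2.2.val = i + 1 then s.1 + 1 else s.1, s.2)) (by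
    rintro ⟨c, x, j⟩
    by_cases hj : j.val = i + 1
    · fin_cases c <;> simp [hj]
    · simp [hj])

/-- The joint state in which the data register holds `β (min i j)` if the workspace holds `j`. -/
def loopState {m w : ℕ} (a : ℕ → ℝ) (β : ℕ → Fin (2 ^ m) → ℂ) (i : ℕ) : State m w := fun s =>
  if s.1 = (if i < s.2.2.val then 1 else 0) then a s.2.2 * β (min i s.2.2) s.2.1 else 0

/-- `n` Grover iterations, of which a state with `j` in the workspace takes part in the
first `j`. -/
def groverLoop {m w : ℕ} (R : Matrix.unitaryGroup (Fin (2 ^ m)) ℂ) (last : Algorithm m w) :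
    ℕ → ℕ → Algorithm m w
  | 0, _ => last
  | n + 1, i => .query (.gate ⟨ctrl w R.1, ctrl_mem_unitaryGroup R.2⟩
      (.gate (permGate (flipPerm m w i)) (groverLoop R last n (i + 1))))

section Loop

variable {m w : ℕ} {R : Matrix.unitaryGroup (Fin (2 ^ m)) ℂ}
  {U : Matrix (Fin (2 ^ m)) (Fin (2 ^ m)) ℂ} {β : ℕ → Fin (2 ^ m) → ℂ}

theorem queries_groverLoop (last : Algorithm m w) (n i : ℕ) :
    (groverLoop R last n i).queries = n + last.queries := by
  induction n generalizing i with
  | zero => simp [groverLoop]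
  | succ n ih => simp only [groverLoop, Algorithm.queries, ih]; omega

/-- The control qubit is set exactly on the branches with `j > i`, so only these advance. The branch
`j = i + 1` has then completed its `j` iterations, and the flip switches its control off. -/
theorem loopState_succ (hβ : ∀ k, R.1.mulVec (U.mulVec (β k)) = β (k + 1)) (a : ℕ → ℝ) (i : ℕ) :
    (permGate (flipPerm m w i)).1.mulVec ((ctrl w R.1).mulVec (applyQuery U (loopState a β i))) =
      loopState a β (i + 1) := by
  have h0 : ∀ x j, applyQuery R.1 (applyQuery U (loopState (w := w) a β i)) (0, x, j) =
      if i < j.val then 0 else a j * β j x := by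
    intro x j
    by_cases hj : i < j.val
    · simp [applyQuery, loopState, hj]
    · simp [applyQuery, loopState, hj, min_eq_right (not_lt.1 hj)]
  have h1 : ∀ x j, applyQuery R.1 (applyQuery U (loopState (w := w) a β i)) (1, x, j) =
      if i < j.val then a j * β (i + 1) x else 0 := by
    intro x j
    by_cases hj : i < j.val
    · rw [if_pos hj, ← hβ i]
      simp only [applyQuery, loopState, hj, min_eq_left hj.le, if_true, Matrix.mulVec, dotProduct,
        Finset.mul_sum]
      refine Finset.sum_congr rfl fun y _ => Finset.sum_congr rfl fun z _ => ?_
      ring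
    · simp [applyQuery, loopState, hj]
  rw [ctrl_mulVec]
  ext ⟨c, x, j⟩
  rw [permGate_mulVec]
  change applyQuery R.1 (applyQuery U (loopState a β i))
    (if j.val = i + 1 then c + 1 else c, x, j) = _
  rcases lt_trichotomy j.val (i + 1) with hj | hj | hj
  · have e1 : ¬ i < j.val := by omega
    have e2 : ¬ i + 1 < j.val := by omega
    rw [if_neg hj.ne]
    fin_cases c
    · simp [h0, loopState, e1, e2, min_eq_right hj.le]
    · simp [h1, loopState, e1, e2]
  · have e1 : i < j.val := by omega
    rw [if_pos hj]
    fin_cases c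
    · simp [h1, loopState, hj]
    · simp [h0, loopState, hj]
  · have e1 : i < j.val := by omega
    rw [if_neg hj.ne']
    fin_cases c
    · simp [h0, loopState, e1, hj]
    · simp [h1, loopState, e1, hj]

theorem expFrom_groverLoop (hβ : ∀ k, R.1.mulVec (U.mulVec (β k)) = β (k + 1)) (a : ℕ → ℝ)
    (F : ℝ → ℝ) (last : Algorithm m w) (n i : ℕ) :
    (groverLoop R last n i).expFrom U F (loopState a β i) =
      last.expFrom U F (loopState a β (i + n)) := by
  induction n generalizing i with
  | zero => rfl
  | succ n ih =>
    simp only [groverLoop, Algorithm.expFrom]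
    rw [loopState_succ hβ, ih, add_right_comm, add_assoc]

theorem normSq_loopState_zero (a : ℕ → ℝ) (ha : ∑ j : Fin (2 ^ w), a j ^ 2 = 1)
    (hβ : normSq (β 0) = 1) : normSq (loopState (w := w) a β 0) = 1 := by
  have h : ∀ (j : Fin (2 ^ w)) x, ‖loopState (w := w) a β 0 (0, x, j)‖ ^ 2 +
      ‖loopState (w := w) a β 0 (1, x, j)‖ ^ 2 = a j ^ 2 * ‖β 0 x‖ ^ 2 := by
    intro j x
    by_cases hj : 0 < j.val
    · simp [loopState, hj, mul_pow]
    · simp [loopState, hj, mul_pow]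
  rw [normSq, Fintype.sum_prod_type, Fin.sum_univ_two, ← Finset.sum_add_distrib,
    Fintype.sum_prod_type]
  simp only [h]
  rw [Finset.sum_comm]
  simp only [← Finset.mul_sum]
  rw [← Finset.sum_mul, ha, one_mul]
  exact hβ

end Loop

/-- Estimation of `√K` with mean square error `O (N / D ^ 2)` by `D - 1` queries, `D = 2 ^ w`. -/
theorem exists_sqrt_estimator {w : ℕ} (hN : 1 ≤ N) (hw : 1 ≤ w) :
    ∃ A : Algorithm (dataQubits N) w, A.queries = 2 ^ w - 1 ∧
      ∀ (f : Fin N → Bool) (K : ℕ), K = (Finset.univ.filter fun x => f x = true).card →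
        ∀ U, IsMembershipOracle f U →
          A.exp U (fun x => (x - √K) ^ 2) ≤ N * ((1 - Real.cos (Real.pi / (2 ^ w : ℕ))) / 2) := by
  have hD : 2 ≤ 2 ^ w := by simpa using Nat.pow_le_pow_right two_pos hw
  set a := sineWindow (2 ^ w) with ha
  -- The first gate must not depend on `f`, so it is built from the uniform superposition; `hinit`
  -- later identifies this with the zeroth Grover state.
  obtain ⟨V, hV⟩ := exists_unitary_mulVec_ket ((0, 0, 0) : Basis (dataQubits N) w)
    (loopState a (fun _ => uniformItems N) 0)
    (normSq_loopState_zero a (sum_sineWindow_sq hD) (normSq_uniformItems hN))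
  let out : Basis (dataQubits N) w → ℝ :=
    fun s => √N * |Real.sin (s.2.2 * (Real.pi / (2 ^ w : ℕ)))|
  let last : Algorithm (dataQubits N) w :=
    .gate (onWork _ (dft (2 ^ w))) (.measure fun s => .output (out s))
  refine ⟨.gate V (groverLoop ⟨diffusion N, diffusion_mem_unitaryGroup hN⟩ last (2 ^ w - 1) 0),
    ?_, fun f K hK U hU => ?_⟩
  · have : last.queries = 0 := Nat.le_zero.1 (Finset.sup_le fun _ _ => le_rfl)
    rw [Algorithm.queries, queries_groverLoop, this, add_zero]
  have hKN : K ≤ N := by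
    rw [hK]; exact (Finset.card_le_univ _).trans_eq (Fintype.card_fin N)
  set θ := groverAngle N K with hθ
  set α := groverAmplitude f K θ with hα
  have hinit : (loopState a (fun _ => uniformItems N) 0 : State (dataQubits N) w) =
      loopState a (fun k => onItems (α k)) 0 := by
    funext s
    simp only [loopState, Nat.zero_min, hα, hθ, onItems_groverAmplitude_zero hN hK]
  rw [Algorithm.exp, Algorithm.expFrom, hV, hinit,
    expFrom_groverLoop (diffusion_mulVec_oracle_mulVec hN hK hU), zero_add]
  -- After `D - 1` rounds every branch `j ≤ D - 1` has stopped, so the control is `0` throughout and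
  -- disentangled.
  have hfin : ∀ (x : Fin (2 ^ dataQubits N)) (j : Fin (2 ^ w)),
      (loopState a (fun k => onItems (α k)) (2 ^ w - 1) : State (dataQubits N) w) (0, x, j) =
        a j * onItems (α j) x ∧
      (loopState a (fun k => onItems (α k)) (2 ^ w - 1) : State (dataQubits N) w) (1, x, j) = 0 := by
    intro x j
    have hj := j.2
    have e : ¬ 2 ^ w - 1 < j.val := by omega
    simp [loopState, e, min_eq_right (not_lt.1 e)]
  simp only [last, Algorithm.expFrom, Fintype.sum_prod_type, Fin.sum_univ_two, onWork_mulVec,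
    (hfin _ _).1, (hfin _ _).2, mul_zero, Finset.sum_const_zero, norm_zero, ne_eq,
    OfNat.ofNat_ne_zero, not_false_eq_true, zero_pow, zero_mul, add_zero]
  rw [Finset.sum_comm]
  have hpt : ∀ t : Fin (2 ^ w), ∑ x, ‖∑ j, (dft (2 ^ w)).1 t j * (a j * onItems (α j) x)‖ ^ 2 *
      (out (0, x, t) - √K) ^ 2 ≤
      N * ((|Real.sin (t * (Real.pi / (2 ^ w : ℕ)))| - |Real.sin θ|) ^ 2 *
        ‖(dft (2 ^ w)).1.mulVec (fun j => a j * Complex.exp ((2 * j + 1) * θ * Complex.I)) t‖ ^ 2 +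
      (|Real.sin (t * (Real.pi / (2 ^ w : ℕ)))| - |Real.sin (-θ)|) ^ 2 *
        ‖(dft (2 ^ w)).1.mulVec
          (fun j => a j * Complex.exp ((2 * j + 1) * ((-θ : ℝ) : ℂ) * Complex.I)) t‖ ^ 2) / 2 := by
    intro t
    have hs : √K = √N * |Real.sin θ| := by
      rw [← abs_of_nonneg (Real.sqrt_nonneg (K : ℝ)), ← sqrt_mul_sin_groverAngle hN hKN, abs_mul,
        abs_of_nonneg (Real.sqrt_nonneg (N : ℝ))]
    have hval : (out (0, 0, t) - √K) ^ 2 =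
        N * (|Real.sin (t * (Real.pi / (2 ^ w : ℕ)))| - |Real.sin θ|) ^ 2 := by
      rw [hs, ← mul_sub, mul_pow, Real.sq_sqrt (Nat.cast_nonneg N)]
    have hsum := sum_norm_sq_groverAmplitude_le hK θ
      (fun j : Fin (2 ^ w) => (dft (2 ^ w)).1 t j * a j) (fun j => j.val)
    change ∑ x, _ * (out (0, 0, t) - √K) ^ 2 ≤ _
    rw [← Finset.sum_mul, sum_items _ fun x hx => by simp [onItems_of_notMem _ hx], hval,
      Real.sin_neg, abs_neg]
    simp only [onItems_item, ← mul_assoc]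
    rw [mul_assoc _ (N : ℝ)]
    refine (mul_le_mul_of_nonneg_right hsum
      (mul_nonneg (Nat.cast_nonneg N) (sq_nonneg _))).trans_eq ?_
    simp only [Matrix.mulVec, dotProduct, mul_assoc]
    ring
  refine (Finset.sum_le_sum fun t _ => hpt t).trans ?_
  rw [← Finset.sum_div, ← Finset.mul_sum, Finset.sum_add_distrib, mul_div_assoc]
  refine mul_le_mul_of_nonneg_left ?_ (Nat.cast_nonneg N)
  linarith [sum_sq_sub_abs_sin_mul_dft_le hD θ, sum_sq_sub_abs_sin_mul_dft_le hD (-θ)]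

end
end QuantumQuery

/-! ### Size of the workspace for a given precision -/

namespace QuantumQuery

noncomputable section

/-- Estimation of `√K` with mean square error `η ^ 2 / 16`. -/
theorem exists_sqrt_estimator_of_precision {N : ℕ} (hN : 1 ≤ N) {η : ℝ} (hη : 0 < η) :
    ∃ (w : ℕ) (A : Algorithm (dataQubits N) w), (A.queries : ℝ) < 14 * √N / η ∧
      (2 : ℝ) ^ w ≤ max 1 (14 * √N / η) ∧
      ∀ (f : Fin N → Bool) (K : ℕ), K = (Finset.univ.filter fun x => f x = true).card →
        ∀ U, IsMembershipOracle f U → A.exp U (fun x => (x - √K) ^ 2) ≤ η ^ 2 / 16 := by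
  have hN0 : 0 < √(N : ℝ) := Real.sqrt_pos.2 (by exact_mod_cast hN)
  rcases le_or_gt (4 * √N) η with h | h
  -- Here `K ≤ N ≤ η²/16`, so the constant `0` is already precise enough.
  · refine ⟨0, .output 0, ?_, by simp, fun f K hK U _ => ?_⟩
    · rw [Algorithm.queries, Nat.cast_zero]
      positivity
    · have hKN : K ≤ N := by
        rw [hK]; exact (Finset.card_le_univ _).trans_eq (Fintype.card_fin N)
      have hKN' : (K : ℝ) ≤ N := by exact_mod_cast hKN
      rw [Algorithm.exp, Algorithm.expFrom, zero_sub, neg_sq, Real.sq_sqrt (Nat.cast_nonneg K)]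
      have := pow_le_pow_left₀ (by positivity) h 2
      rw [mul_pow, Real.sq_sqrt (Nat.cast_nonneg N)] at this
      linarith
  · obtain ⟨n, hn, hn'⟩ := exists_nat_pow_near (x := 7 * √N / η) (y := (2 : ℝ))
      ((one_le_div hη).2 (by linarith)) one_lt_two
    obtain ⟨A, hA, hexp⟩ := exists_sqrt_estimator (w := n + 1) hN (by omega)
    have hpow : (2 : ℝ) ^ (n + 1) ≤ 14 * √N / η := by
      rw [pow_succ, show 14 * √N / η = 7 * √N / η * 2 by ring]
      linarith
    refine ⟨n + 1, A, ?_, hpow.trans (le_max_right _ _), fun f K hK U hU => ?_⟩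
    · refine lt_of_lt_of_le ?_ hpow
      rw [hA]
      exact_mod_cast Nat.sub_lt (by positivity) one_pos
    · refine (hexp f K hK U hU).trans ?_
      have hcos := Real.one_sub_sq_div_two_le_cos (x := Real.pi / (2 ^ (n + 1) : ℕ))
      have hD : (0 : ℝ) < 2 ^ (n + 1) := by positivity
      -- The `7` in the choice of `n` serves `π ≤ 7/2`. With `1 - cos x ≤ x²/2` the error is then at
      -- most `(η/2)²/4 = η²/16`.
      have h1 : √N * (Real.pi / 2 ^ (n + 1)) ≤ η / 2 := by
        rw [div_lt_iff₀ hη] at hn'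
        rw [mul_div_assoc', div_le_iff₀ hD]
        nlinarith [Real.pi_lt_d2]
      have h2 := pow_le_pow_left₀ (by positivity) h1 2
      rw [mul_pow, Real.sq_sqrt (Nat.cast_nonneg N)] at h2
      push_cast at hcos ⊢
      have h3 := mul_le_mul_of_nonneg_left (sub_le_comm.1 hcos) (Nat.cast_nonneg (α := ℝ) N)
      linarith

/-! ### Amplification of the success probability -/

namespace Algorithm

variable {m w : ℕ}

/-- Run `A` a number of times and process the list of all outputs. -/
def repeatRun (A : Algorithm m w) (post : List ℝ → ℝ) : ℕ → List ℝ → Algorithm m w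
  | 0, l => output (post l)
  | n + 1, l => bind (fun x => repeatRun A post n (x :: l)) A

theorem queries_repeatRun_le (A : Algorithm m w) (post : List ℝ → ℝ) (n : ℕ) (l : List ℝ) :
    (repeatRun A post n l).queries ≤ n * A.queries := by
  induction n generalizing l with
  | zero => simp [repeatRun, queries]
  | succ n ih =>
    refine (queries_bind_le (fun x => ih (x :: l)) A).trans_eq ?_
    ring

/-- A Chernoff argument: each independent run multiplies the expectation of the product of penalties
`b` by at most `2`, and the failure probability is at most `c` times that product. -/
theorem le_exp_repeatRun {U : Matrix (Fin (2 ^ m)) (Fin (2 ^ m)) ℂ}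
    (hU : U ∈ Matrix.unitaryGroup (Fin (2 ^ m)) ℂ) {A : Algorithm m w} {b : ℝ → ℝ}
    (hb0 : ∀ x, 0 ≤ b x) (hb : exp U b A ≤ 2) {c : ℝ} (hc : 0 ≤ c) {post : List ℝ → ℝ}
    {F : ℝ → ℝ} {k : ℕ} (hF : ∀ l, l.length = k → 1 - c * (l.map b).prod ≤ F (post l))
    (n : ℕ) (l : List ℝ) (hl : l.length + n = k) :
    1 - c * (l.map b).prod * 2 ^ n ≤ exp U F (repeatRun A post n l) := by
  induction n generalizing l with
  | zero => simpa [repeatRun, exp, expFrom] using hF l hl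
  | succ n ih =>
    have hP : 0 ≤ c * (l.map b).prod * 2 ^ n := by
      refine mul_nonneg (mul_nonneg hc (List.prod_nonneg ?_)) (by positivity)
      simp only [List.mem_map]
      rintro _ ⟨x, _, rfl⟩
      exact hb0 x
    rw [repeatRun, exp_bind hU]
    calc _ ≤ 1 + -(c * (l.map b).prod * 2 ^ n) * exp U b A := by
          rw [pow_succ]
          nlinarith
      _ = exp U (fun x => 1 + -(c * (l.map b).prod * 2 ^ n) * b x) A := (exp_affine hU _ _ _ _).symm
      _ ≤ _ := exp_mono (fun x => le_trans (le_of_eq ?_) (ih (x :: l) ?_)) A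
    · rw [List.map_cons, List.prod_cons]
      ring
    · rw [List.length_cons]
      omega

end Algorithm

open Classical in
/-- The number of elements of a list within distance `η` of `c`. -/
def countNear (η c : ℝ) (l : List ℝ) : ℕ := l.countP fun x => |x - c| ≤ η

open Classical in
/-- A number within distance `η` of more than half of the elements of a list. -/
def majorityPoint (η : ℝ) (l : List ℝ) : ℝ :=
  if h : ∃ c, l.length < 2 * countNear η c l then h.choose else 0

/-- Two majorities share an element, and that element is within `η` of both centres. -/
theorem abs_sub_le_of_countNear {η c d : ℝ} {l : List ℝ} (hc : l.length < 2 * countNear η c l)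
    (hd : l.length < 2 * countNear η d l) : |c - d| ≤ 2 * η := by
  by_contra! h
  have key : ∀ l : List ℝ, countNear η c l + countNear η d l ≤ l.length := by
    intro l
    induction l with
    | nil => simp [countNear]
    | cons x l ih =>
      simp only [countNear, List.countP_cons, List.length_cons, decide_eq_true_eq] at ih ⊢
      by_cases h1 : |x - c| ≤ η
      · have h2 : ¬ |x - d| ≤ η := fun h2 => by
          have := abs_sub_le c x d
          rw [abs_sub_comm c x] at this
          linarith
        rw [if_pos h1, if_neg h2]
        omega
      · rw [if_neg h1]
        split_ifs <;> omega
  have := key l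
  omega

theorem abs_majorityPoint_sub_le {η s : ℝ} {l : List ℝ} (h : l.length < 2 * countNear η s l) :
    |majorityPoint η l - s| ≤ 2 * η := by
  have hex : ∃ c, l.length < 2 * countNear η c l := ⟨s, h⟩
  rw [majorityPoint, dif_pos hex]
  exact abs_sub_le_of_countNear hex.choose_spec h

open Classical in
theorem prod_map_ite_mul_pow_countNear (η s : ℝ) (l : List ℝ) :
    (l.map fun x => if |x - s| ≤ η then (1 : ℝ) else 16).prod * 16 ^ countNear η s l =
      16 ^ l.length := by
  induction l with
  | nil => simp [countNear]
  | cons x l ih =>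
    simp only [countNear, List.countP_cons, List.length_cons, decide_eq_true_eq, List.map_cons,
      List.prod_cons] at ih ⊢
    split_ifs <;> rw [pow_add] <;> rw [pow_succ _ l.length, ← ih] <;> ring

/-- Repetition makes the failure probability exponentially small. -/
theorem le_exp_repeatRun_majorityPoint {m w : ℕ} {U : Matrix (Fin (2 ^ m)) (Fin (2 ^ m)) ℂ}
    (hU : U ∈ Matrix.unitaryGroup (Fin (2 ^ m)) ℂ) {A : Algorithm m w} {η s : ℝ} (hη : 0 < η)
    (hA : A.exp U (fun x => (x - s) ^ 2) ≤ η ^ 2 / 16) {F : ℝ → ℝ} (hF0 : ∀ y, 0 ≤ F y)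
    (hF : ∀ y, |y - s| ≤ 2 * η → 1 ≤ F y) (n : ℕ) :
    1 - (1 / 2) ^ n ≤ (A.repeatRun (majorityPoint η) n []).exp U F := by
  classical
  -- By Chebyshev a far output has probability at most `1/16`, so `b` has mean at most `1 + 15/16`.
  -- If the majority fails, at least half the outputs are far and the product is at least `16 ^
  -- (n/2) = 4 ^ n`; hence failure has probability at most `2 ^ n / 4 ^ n`.
  set b : ℝ → ℝ := fun x => if |x - s| ≤ η then 1 else 16 with hb
  have hb0 : ∀ x, 0 ≤ b x := fun x => by
    rw [hb]
    dsimp only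
    split_ifs <;> norm_num
  have hb2 : A.exp U b ≤ 2 := by
    have hpt : ∀ x, b x ≤ 1 + 15 / η ^ 2 * (x - s) ^ 2 := by
      intro x
      have h0 : 0 ≤ 15 / η ^ 2 * (x - s) ^ 2 := by positivity
      rw [hb]
      dsimp only
      split_ifs with hx
      · linarith
      · have := pow_lt_pow_left₀ (not_le.1 hx) hη.le two_ne_zero
        rw [sq_abs] at this
        have h1 : 15 ≤ 15 / η ^ 2 * (x - s) ^ 2 := by
          rw [div_mul_eq_mul_div, le_div_iff₀ (by positivity)]
          linarith
        linarith
    refine (Algorithm.exp_mono hpt A).trans ?_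
    rw [Algorithm.exp_affine hU]
    have : 15 / η ^ 2 * A.exp U (fun x => (x - s) ^ 2) ≤ 15 / η ^ 2 * (η ^ 2 / 16) :=
      mul_le_mul_of_nonneg_left hA (by positivity)
    have h2 : 15 / η ^ 2 * (η ^ 2 / 16) = 15 / 16 := by field_simp
    linarith
  have h := Algorithm.le_exp_repeatRun hU hb0 hb2 (c := 1 / 4 ^ n) (by positivity)
    (post := majorityPoint η) (F := F) (k := n) (fun l hl => ?_) n [] (by simp)
  · refine le_trans (le_of_eq ?_) h
    rw [List.map_nil, List.prod_nil, mul_one, show (4 : ℝ) = 2 * 2 by norm_num, mul_pow,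
      div_pow, one_pow]
    field_simp
  · have hP : 0 ≤ (l.map b).prod := List.prod_nonneg fun y hy => by
      obtain ⟨x, _, rfl⟩ := List.mem_map.1 hy
      exact hb0 x
    rcases lt_or_ge l.length (2 * countNear η s l) with hc | hc
    · have := hF _ (abs_majorityPoint_sub_le hc)
      have h0 : 0 ≤ 1 / 4 ^ n * (l.map b).prod := by positivity
      linarith
    · refine le_trans ?_ (hF0 _)
      have h16 := prod_map_ite_mul_pow_countNear η s l
      have hle : (16 : ℝ) ^ countNear η s l ≤ 4 ^ n := by
        rw [show (16 : ℝ) = 4 ^ 2 by norm_num, ← pow_mul]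
        exact pow_le_pow_right₀ (by norm_num) (by omega)
      have h4 : (4 : ℝ) ^ n * 4 ^ n ≤ (l.map b).prod * 4 ^ n := by
        rw [← mul_pow, show (4 * 4 : ℝ) = 16 by norm_num, ← hl, ← h16, hl]
        exact mul_le_mul_of_nonneg_left hle hP
      rw [sub_nonpos, one_div_mul_eq_div, one_le_div (by positivity)]
      exact le_of_mul_le_mul_right h4 (by positivity)

/-! ### Failure probabilities near one, and the two regimes combined -/

/-- Guessing a refinement of an estimate. -/
theorem exists_guess {m w : ℕ} (A : Algorithm m w) {ε : ℝ} (hε : 0 < ε) {M : ℕ} (hM : 1 ≤ M) :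
    ∃ B : Algorithm m w, B.queries ≤ A.queries ∧
      ∀ U ∈ Matrix.unitaryGroup (Fin (2 ^ m)) ℂ, ∀ s : ℝ,
        A.exp U (fun x => (x - s) ^ 2) ≤ (M * ε) ^ 2 / 16 → ∀ F : ℝ → ℝ, (∀ y, 0 ≤ F y) →
          (∀ y, |y - s| ≤ ε / 3 → 1 ≤ F y) → 15 / 16 / (6 * M + 1) ≤ B.exp U F := by
  choose G hG hexp using fun r : ℝ =>
    Algorithm.exists_uniform m w (6 * M) fun i => r + (i - 3 * M) * (ε / 3)
  refine ⟨A.bind G, by simpa using Algorithm.queries_bind_le (fun r => (hG r).le) A,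
    fun U hU s hA F hF0 hF => ?_⟩
  have hM0 : (0 : ℝ) < M := by exact_mod_cast hM
  have hpos : (0 : ℝ) < M * ε := by positivity
  -- `1 - ((r - s)/(Mε))²` lies below the indicator of `|r - s| ≤ Mε` and is affine in the squared
  -- error, so the mean square bound applies. On that event the grid of spacing `ε/3` covers `s`, so
  -- one of its `6M+1` points is a hit.
  have hpt : ∀ r, 1 / (6 * M + 1) + -(1 / (6 * M + 1) / (M * ε) ^ 2) * (r - s) ^ 2 ≤
      (G r).exp U F := by
    intro r
    have hsum0 : 0 ≤ ∑ i ∈ Finset.range (6 * M + 1), F (r + (i - 3 * M) * (ε / 3)) :=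
      Finset.sum_nonneg fun i _ => hF0 _
    have h1 : 1 / (6 * M + 1) + -(1 / (6 * M + 1) / (M * ε) ^ 2) * (r - s) ^ 2 =
        (1 - ((r - s) / (M * ε)) ^ 2) / (6 * M + 1) := by
      rw [div_pow]
      ring
    rw [hexp r U hU, h1]
    push_cast
    refine div_le_div_of_nonneg_right ?_ (by positivity)
    rcases le_or_gt |r - s| (M * ε) with hr | hr
    · have hq : 0 ≤ (s - r) / (ε / 3) + 3 * M := by
        rw [div_add' _ _ _ (by positivity)]
        refine div_nonneg ?_ (by positivity)
        linarith [(abs_le.1 hr).2]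
      have hq' : (s - r) / (ε / 3) + 3 * M ≤ 6 * M := by
        rw [← le_sub_iff_add_le, div_le_iff₀ (by positivity)]
        linarith [(abs_le.1 hr).1]
      have hmem : ⌊(s - r) / (ε / 3) + 3 * M⌋₊ ∈ Finset.range (6 * M + 1) := by
        rw [Finset.mem_range, Nat.lt_succ_iff]
        refine Nat.floor_le_of_le ?_
        push_cast
        exact hq'
      have hone : 1 ≤ F (r + (⌊(s - r) / (ε / 3) + 3 * M⌋₊ - 3 * M) * (ε / 3)) := by
        have hs : s = r + ((s - r) / (ε / 3) + 3 * M - 3 * M) * (ε / 3) := by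
          field_simp
          ring
        have hl := Nat.floor_le hq
        have hu := Nat.lt_floor_add_one ((s - r) / (ε / 3) + 3 * M)
        refine hF _ ?_
        rw [abs_le]
        set q := (s - r) / (ε / 3) + 3 * M
        constructor <;> nlinarith
      have := Finset.single_le_sum (f := fun i : ℕ => F (r + (i - 3 * M) * (ε / 3)))
        (fun i _ => hF0 _) hmem
      linarith [sq_nonneg ((r - s) / (M * ε))]
    · have : 1 ≤ ((r - s) / (M * ε)) ^ 2 := by
        rw [one_le_sq_iff_one_le_abs, abs_div, abs_of_pos hpos, one_le_div hpos]
        exact hr.le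
      linarith
  rw [Algorithm.exp_bind hU]
  refine le_trans ?_ (Algorithm.exp_mono hpt A)
  rw [Algorithm.exp_affine hU]
  have h2 := mul_le_mul_of_nonneg_left hA
    (by positivity : (0 : ℝ) ≤ 1 / (6 * M + 1) / (M * ε) ^ 2)
  have h3 : 1 / (6 * M + 1) / (M * ε) ^ 2 * ((M * ε) ^ 2 / 16) = 1 / 16 / (6 * M + 1) := by
    field_simp
  have h4 : (15 / 16 / (6 * M + 1) : ℝ) = 1 / (6 * M + 1) - 1 / 16 / (6 * M + 1) := by ring
  linarith

/-- Estimation of `√K` with additive error `ε / 3` and failure probability `ζ`. -/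
theorem exists_sqrt_estimator_of_failure_prob {N : ℕ} (hN : 1 ≤ N) {ε ζ : ℝ} (hε : 0 < ε)
    (hζ0 : 0 < ζ) (hζ1 : ζ < 1) :
    ∃ (w : ℕ) (A : Algorithm (dataQubits N) w),
      (A.queries : ℝ) < 1176 * (ε⁻¹ * √N * Real.log (1 / ζ)) ∧
      (2 : ℝ) ^ w ≤ max 1 (84 * √N / ε) ∧
      ∀ (f : Fin N → Bool) (K : ℕ), K = (Finset.univ.filter fun x => f x = true).card →
        ∀ U, IsMembershipOracle f U → ∀ F : ℝ → ℝ, (∀ y, 0 ≤ F y) →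
          (∀ y, |y - √K| ≤ ε / 3 → 1 ≤ F y) → 1 - ζ ≤ A.exp U F := by
  have hN0 : 0 < √(N : ℝ) := Real.sqrt_pos.2 (by exact_mod_cast hN)
  have hL : 1 - ζ ≤ Real.log (1 / ζ) := by
    simpa using Real.one_sub_inv_le_log_of_pos (x := 1 / ζ) (by positivity)
  set L := Real.log (1 / ζ) with hLdef
  -- Below the threshold `log (1/ζ) ≥ 1/12` absorbs the rounding up of the number of runs: `2L + 1 ≤
  -- 14L`, and `14 * 84 = 1176`. Above it, `(6M + 1)(1 - ζ) ≤ 6/8 + 1/12 < 15/16`.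
  rcases le_or_gt ζ (11 / 12) with hζ | hζ
  · obtain ⟨w, A, hq, hw, hA⟩ := exists_sqrt_estimator_of_precision hN (η := ε / 6) (by positivity)
    have e : 14 * √N / (ε / 6) = 84 * √N / ε := by
      rw [div_div_eq_mul_div]
      ring
    rw [e] at hq hw
    set n := ⌈2 * L⌉₊ with hn
    have hLpos : 1 / 12 ≤ L := by linarith
    have hn0 : 0 < n := Nat.ceil_pos.2 (by linarith)
    have hnL : (n : ℝ) ≤ 14 * L := by linarith [Nat.ceil_lt_add_one (by linarith : 0 ≤ 2 * L)]
    have hnζ : (1 / 2 : ℝ) ^ n ≤ ζ := by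
      rw [← Real.log_le_log_iff (by positivity) hζ0, Real.log_pow, one_div, Real.log_inv]
      have h2 : (1 / 2 : ℝ) ≤ Real.log 2 := by linarith [Real.log_two_gt_d9]
      have h3 : Real.log ζ = -L := by rw [hLdef, one_div, Real.log_inv, neg_neg]
      have h4 : 2 * L ≤ n := Nat.le_ceil _
      rw [h3]
      nlinarith
    refine ⟨w, A.repeatRun (majorityPoint (ε / 6)) n [], ?_, hw, fun f K hK U hU F hF0 hF => ?_⟩
    · have h1 : ((A.repeatRun (majorityPoint (ε / 6)) n []).queries : ℝ) ≤ n * A.queries := by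
        exact_mod_cast A.queries_repeatRun_le (majorityPoint (ε / 6)) n []
      have h2 : (n : ℝ) * A.queries < n * (84 * √N / ε) :=
        mul_lt_mul_of_pos_left hq (by exact_mod_cast hn0)
      have h3 : (n : ℝ) * (84 * √N / ε) ≤ 14 * L * (84 * √N / ε) :=
        mul_le_mul_of_nonneg_right hnL (by positivity)
      have h4 : 14 * L * (84 * √N / ε) = 1176 * (ε⁻¹ * √N * L) := by ring
      linarith
    · have := le_exp_repeatRun_majorityPoint hU.1 (by positivity) (hA f K hK U hU) hF0
        (fun y hy => hF y (by linarith)) n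
      linarith
  · have hδ : 0 < 1 - ζ := by linarith
    set x := 1 / (8 * (1 - ζ)) with hx
    have hx1 : 1 ≤ x := (one_le_div (by positivity)).2 (by linarith)
    set M := ⌊x⌋₊ with hMdef
    have hM : 1 ≤ M := Nat.le_floor (by simpa using hx1)
    have hM1 : (1 : ℝ) ≤ M := by exact_mod_cast hM
    have hMx : (M : ℝ) ≤ x := Nat.floor_le (by linarith)
    have hxM : x < M + 1 := Nat.lt_floor_add_one x
    have hxδ : x * (8 * (1 - ζ)) = 1 := one_div_mul_cancel (by positivity)
    have hMδ : (M : ℝ) * (8 * (1 - ζ)) ≤ 1 :=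
      (mul_le_mul_of_nonneg_right hMx (by positivity)).trans_eq hxδ
    have hδM : 1 ≤ M * (16 * (1 - ζ)) := by nlinarith
    obtain ⟨w, A, hq, hw, hA⟩ := exists_sqrt_estimator_of_precision hN (η := M * ε) (by positivity)
    obtain ⟨B, hB, hBexp⟩ := exists_guess A hε hM
    refine ⟨w, B, ?_, hw.trans (max_le_max le_rfl ?_), fun f K hK U hU F hF0 hF => ?_⟩
    · have h1 : (B.queries : ℝ) ≤ A.queries := by exact_mod_cast hB
      have h2 : 14 * √N / (M * ε) ≤ 1176 * (ε⁻¹ * √N * L) := by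
        have h3 : 1 ≤ 84 * (M * L) := by nlinarith
        have h4 : 1176 * (ε⁻¹ * √N * L) = 14 * √N * (84 * (M * L)) / (M * ε) := by
          field_simp
          ring
        rw [h4]
        exact div_le_div_of_nonneg_right (le_mul_of_one_le_right (by positivity) h3) (by positivity)
      linarith
    · exact div_le_div₀ (by positivity) (by linarith) hε (le_mul_of_one_le_left hε.le hM1)
    · refine le_trans ?_ (hBexp U hU.1 _ (hA f K hK U hU) F hF0 hF)
      rw [le_div_iff₀ (by positivity)]
      nlinarith

/-! ### The estimate of the number of marked items -/

/-- The estimate of `K` obtained from an estimate of `√K` with error `ε / 3`. -/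
def countOfSqrt (ε r : ℝ) : ℝ := if r ≤ 2 * ε / 3 then 1 else r ^ 2

/-- Squaring costs at most `(2√K + ε/3)(ε/3)`, which is below `ε√K` exactly when `√K > ε/3`; the
cutoff `2ε/3` guarantees this. Below the cutoff `√K ≤ ε`, and the answer `1` works since `K - 1 < K
≤ ε√K`. -/
theorem abs_countOfSqrt_sub_lt {ε r : ℝ} {K : ℕ} (hε : 0 < ε) (hK : 0 < K) (hr : |r - √K| ≤ ε / 3) :
    |countOfSqrt ε r - K| < ε * √K := by
  have hK1 : (1 : ℝ) ≤ K := by exact_mod_cast hK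
  have hs1 : 1 ≤ √(K : ℝ) := Real.one_le_sqrt.2 hK1
  have hsq : √(K : ℝ) ^ 2 = K := Real.sq_sqrt (Nat.cast_nonneg K)
  obtain ⟨h1, h2⟩ := abs_le.1 hr
  rw [countOfSqrt]
  split_ifs with h
  · have hle : √(K : ℝ) ≤ ε := by linarith
    rw [abs_sub_comm, abs_of_nonneg (by linarith)]
    nlinarith
  · push Not at h
    have key : ∀ s : ℝ, |r - s| ≤ ε / 3 → |r ^ 2 - s ^ 2| < ε * s := by
      intro s hs
      have hsε : ε / 3 < s := by linarith [(abs_le.1 hs).2]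
      rw [sq_sub_sq, abs_mul, abs_of_nonneg (by linarith : 0 ≤ r + s)]
      calc (r + s) * |r - s| ≤ (2 * s + ε / 3) * (ε / 3) :=
            mul_le_mul (by linarith [(abs_le.1 hs).2]) hs (abs_nonneg _) (by linarith)
        _ < ε * s := by nlinarith
    simpa only [hsq] using key _ hr

theorem qubits_le {N w : ℕ} (hN : 1 ≤ N) (hw : (2 : ℝ) ^ w ≤ 168 * N) :
    ((1 + dataQubits N + w : ℕ) : ℝ) ≤ 24 * Real.log (N + 1) := by
  have hN1 : (1 : ℝ) ≤ N := by exact_mod_cast hN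
  have hm : (2 : ℝ) ^ dataQubits N ≤ 2 * N := by
    rcases hN.eq_or_lt with rfl | h
    · norm_num [dataQubits]
    · have h1 := Nat.pow_pred_clog_lt_self one_lt_two h
      have h0 := Nat.clog_pos one_lt_two h
      have : 2 ^ dataQubits N ≤ 2 * N := by
        rw [dataQubits, ← Nat.succ_pred_eq_of_pos h0, pow_succ]
        omega
      exact_mod_cast this
  have hpow : (2 : ℝ) ^ (1 + dataQubits N + w) ≤ (N + 1) ^ 12 := by
    calc (2 : ℝ) ^ (1 + dataQubits N + w) = 2 * 2 ^ dataQubits N * 2 ^ w := by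
          rw [pow_add, pow_add, pow_one]
      _ ≤ 2 * (2 * N) * (168 * N) := by gcongr
      _ ≤ 2 ^ 10 * (N + 1) ^ 2 := by nlinarith
      _ ≤ (N + 1) ^ 10 * (N + 1) ^ 2 := by
          gcongr
          linarith
      _ = (N + 1) ^ 12 := by ring
  have hlog := Real.log_le_log (by positivity) hpow
  rw [Real.log_pow, Real.log_pow] at hlog
  have h2 : (1 / 2 : ℝ) ≤ Real.log 2 := by linarith [Real.log_two_gt_d9]
  have := mul_le_mul_of_nonneg_left h2 (Nat.cast_nonneg (α := ℝ) (1 + dataQubits N + w))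
  push_cast at hlog this ⊢
  linarith

end
end QuantumQuery

/-! ### Assembly of the final algorithm -/

theorem mainTheorem2 :
    ∃ C : ℝ, 0 < C ∧
      ∀ (N : ℕ) (ε ζ : ℝ), 1 ≤ N → 0 < ε → 0 < ζ → ζ < 1 →
        ∃ (w : ℕ) (A : QuantumQuery.Algorithm (QuantumQuery.dataQubits N) w),
          (A.queries : ℝ) < C * (ε⁻¹ * Real.sqrt N * Real.log (1 / ζ)) ∧
          (A.qubits : ℝ) ≤ C * Real.log (N + 1) ∧
          ∀ (f : Fin N → Bool) (K : ℕ),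
            K = (Finset.univ.filter fun x => f x = true).card → 0 < K →
            ∀ U : Matrix (Fin (2 ^ QuantumQuery.dataQubits N))
                (Fin (2 ^ QuantumQuery.dataQubits N)) ℂ,
              QuantumQuery.IsMembershipOracle f U →
              1 - ζ ≤ A.prob U {k : ℝ | |k - K| < ε * Real.sqrt K} := by
  refine ⟨1176, by norm_num, fun N ε ζ hN hε hζ0 hζ1 => ?_⟩
  have hN1 : (1 : ℝ) ≤ N := by exact_mod_cast hN
  have hN0 : 0 < √(N : ℝ) := Real.sqrt_pos.2 (by linarith)
  have hlogζ : 0 < Real.log (1 / ζ) := Real.log_pos ((one_lt_div hζ0).2 hζ1)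
  have hlogN : 0 ≤ Real.log (N + 1) := Real.log_nonneg (by linarith)
  -- The cap keeps `84√N/ε'` at most `168N`, hence the workspace logarithmic in `N`.
  set ε' := max ε (1 / (2 * √N)) with hε'
  have hεε' : ε ≤ ε' := le_max_left _ _
  obtain ⟨w, A, hq, hw, hA⟩ := QuantumQuery.exists_sqrt_estimator_of_failure_prob hN
    (hε.trans_le hεε') hζ0 hζ1
  have hw' : (2 : ℝ) ^ w ≤ 168 * N := by
    refine hw.trans (max_le (by linarith) ?_)
    rw [div_le_iff₀ (hε.trans_le hεε')]
    have h1 : 168 * N * (1 / (2 * √N)) ≤ 168 * (N : ℝ) * ε' :=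
      mul_le_mul_of_nonneg_left (le_max_right _ _) (by positivity)
    refine le_trans (le_of_eq ?_) h1
    have := Real.mul_self_sqrt (Nat.cast_nonneg (α := ℝ) N)
    field_simp
    linarith
  let g : ℝ → ℝ := fun r => if 1 / (2 * √N) ≤ ε then QuantumQuery.countOfSqrt ε' r
    else round (QuantumQuery.countOfSqrt ε' r)
  refine ⟨w, A.map g, ?_, ?_, fun f K hK hK0 U hU => ?_⟩
  · rw [QuantumQuery.Algorithm.queries_map]
    refine hq.trans_le ?_
    gcongr
  · exact (QuantumQuery.qubits_le hN hw').trans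
      (mul_le_mul_of_nonneg_right (by norm_num) hlogN)
  · rw [QuantumQuery.Algorithm.prob_eq_exp, QuantumQuery.Algorithm.exp_map]
    refine hA f K hK U hU _ (fun y => Set.indicator_nonneg (fun _ _ => zero_le_one) _)
      fun y hy => ?_
    have hlt := QuantumQuery.abs_countOfSqrt_sub_lt (hε.trans_le hεε') hK0 hy
    have hKpos : 0 < √(K : ℝ) := Real.sqrt_pos.2 (by exact_mod_cast hK0)
    have hmem : g y ∈ {k : ℝ | |k - K| < ε * √K} := by
      change |g y - K| < ε * √K
      by_cases h : 1 / (2 * √N) ≤ ε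
      · rw [max_eq_left h] at hε'
        rw [show g y = QuantumQuery.countOfSqrt ε' y from if_pos h]
        rwa [← hε']
      · rw [max_eq_right (not_le.1 h).le] at hε'
        have hKN : K ≤ N := by
          rw [hK]; exact (Finset.card_le_univ _).trans_eq (Fintype.card_fin N)
        -- The error is strictly below `1/2`, so rounding returns `K` itself.
        have hhalf : ε' * √K ≤ 1 / 2 := by
          have : √(K : ℝ) ≤ √N := Real.sqrt_le_sqrt (by exact_mod_cast hKN)
          rw [hε', one_div_mul_eq_div, div_le_iff₀ (by positivity)]
          linarith
        have hround : round (QuantumQuery.countOfSqrt ε' y) = (K : ℤ) := by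
          obtain ⟨h1, h2⟩ := abs_lt.1 (hlt.trans_le hhalf)
          rw [round_eq, Int.floor_eq_iff]
          push_cast
          constructor <;> linarith
        rw [show g y = round (QuantumQuery.countOfSqrt ε' y) from if_neg h, hround, Int.cast_natCast,
          sub_self, abs_zero]
        positivity
    rw [Set.indicator_of_mem hmem]
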